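/- Let $F\subset\mathbb R$ be a closed set, $0<\alpha\le 1$ and $l\in\mathbb R$. **Staircase function.** For a subdivision $P=\{x=x_0,\dots,x_n=y\}$ of $[x,y]$ put $\sigma^\alpha[F,P]=\sum_{i<n}\frac{(x_{i+1}-x_i)^\alpha}{\Gamma(\alpha+1)}\Theta(F,[x_i,x_{i+1}])$, where $\Theta(F,I)=1$ if $F\cap I\ne\emptyset$ and $\Theta(F,I)=0$ otherwise; let $\gamma^\alpha(F,x,y)=\lim_{\delta\to0}\inf_{|P|\le\delta}\sigma^\alpha[F,P]\in[0,\infty]$, and let $S(x)=S_F^\alpha(x)=\gamma^\alpha(F,l,x)$ for $x\ge l$ and $S(x)=-\gamma^\alpha(F,x,l)$ for $x<l$. Assume that $\gamma^\alpha(F,x,y)<\infty$ for all $x\le y$, that $S(0)=0$, and that $S(t)\to\infty$ as $t\to\infty$. **Integral.** A function $h$ is $F^\alpha$-integrable over $[a,b]$ if it is bounded on $F\cap[a,b]$ and $\sup_P\sum_i m_i\,(S(x_{i+1})-S(x_i))=\inf_P\sum_i M_i\,(S(x_{i+1})-S(x_i))$, where $P$ runs over the subdivisions of $[a,b]$ and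 $m_i,M_i$ are the infimum and the supremum of $h$ over $F\cap[x_i,x_{i+1}]$ ($0$ if this set is empty); the common value is $\int_a^b h(t)\,d_F^\alpha t$. Moreover $\int_0^\infty h(t)\,d_F^\alpha t=\lim_{b\to\infty}\int_0^b h(t)\,d_F^\alpha t$, which exists if $h$ is $F^\alpha$-integrable over every $[0,b]$ and the limit exists; it converges absolutely if it exists and the integral of $|h|$ exists as well. **Transforms.** For $f:[0,\infty)\to\mathbb R$ let $$\mathfrak L[f](v)=\int_0^\infty e^{-S(v)S(t)}f(S(t))\,d_F^\alpha t,\qquad \mathscr S[f](v)=\frac1{S(v)}\int_0^\infty e^{-S(t)/S(v)}f(S(t))\,d_F^\alpha t\quad(S(v)\neq0),$$ where the integrals exist, and for $f,g:[0,\infty)\to\mathbb R$ and $t\ge0$ let $$(f*g)(S(t))=\int_0^t f(S(t)-S(z))\,g(S(z))\,d_F^\alpha z.$$ **Proposition.** Let $f,g:[0,\infty)\to\mathbb R$ and $v\in\mathbb R$. 1. Suppose that $\mathfrak L[f](v)$ and $\mathfrak L[g](v)$ exist. Then the integral defining $(f*g)(S(t))$ exists for all $t\ge0$; if at least one of the integrals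 defining $\mathfrak L[f](v)$ and $\mathfrak L[g](v)$ converges absolutely, then $\mathfrak L[f*g](v)$ exists; and whenever $\mathfrak L[f*g](v)$ exists, $$\mathfrak L[f*g](v)=\mathfrak L[f](v)\,\mathfrak L[g](v).$$ 2. Suppose that $S(v)\ne0$ and that $\mathscr S[f](v)$ and $\mathscr S[g](v)$ exist. Then the integral defining $(f*g)(S(t))$ exists for all $t\ge0$; if at least one of the integrals defining $\mathscr S[f](v)$ and $\mathscr S[g](v)$ converges absolutely, then $\mathscr S[f*g](v)$ exists; and whenever $\mathscr S[f*g](v)$ exists, $$\mathscr S[f*g](v)=S(v)\,\mathscr S[f](v)\,\mathscr S[g](v).$$ -/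

import Mathlib

open Filter Topology
open scoped ENNReal

namespace FractalCalculus

noncomputable section

/-- `p 0, …, p n` is a subdivision `x = p 0 ≤ p 1 ≤ … ≤ p n = y` of `[x, y]`. Repeated points are
harmless: a degenerate piece contributes `0` to every sum below. -/
def IsSubdivision (x y : ℝ) (n : ℕ) (p : ℕ → ℝ) : Prop :=
  p 0 = x ∧ p n = y ∧ ∀ i < n, p i ≤ p (i + 1)

open Classical in
/-- The flag function `Θ(F, [x, y])`. -/
def flag (F : Set ℝ) (x y : ℝ) : ℝ := if (F ∩ Set.Icc x y).Nonempty then 1 else 0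

/-- The sum `σ^α[F, P]`. -/
def flagSum (F : Set ℝ) (α : ℝ) (n : ℕ) (p : ℕ → ℝ) : ℝ :=
  ∑ i ∈ Finset.range n, (p (i + 1) - p i) ^ α / Real.Gamma (α + 1) * flag F (p i) (p (i + 1))

/-- The coarse-grained mass `γ_δ^α(F, x, y)`: the infimum of `σ^α[F, P]` over the subdivisions `P`
of `[x, y]` with mesh at most `δ`. -/
def coarseMass (F : Set ℝ) (α δ x y : ℝ) : ℝ≥0∞ :=
  ⨅ (n : ℕ) (p : ℕ → ℝ) (_ : IsSubdivision x y n p) (_ : ∀ i < n, p (i + 1) - p i ≤ δ),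
    ENNReal.ofReal (flagSum F α n p)

/-- The mass function `γ^α(F, x, y) = lim_{δ → 0} γ_δ^α(F, x, y) ∈ [0, ∞]`. The coarse-grained mass
increases as `δ` decreases, so the limit is a supremum; see `tendsto_coarseMass`. -/
def mass (F : Set ℝ) (α x y : ℝ) : ℝ≥0∞ := ⨆ (δ : ℝ) (_ : 0 < δ), coarseMass F α δ x y

theorem tendsto_coarseMass (F : Set ℝ) (α x y : ℝ) :
    Tendsto (fun δ => coarseMass F α δ x y) (𝓝[>] 0) (𝓝 (mass F α x y)) := by
  have hanti : Antitone (fun δ => coarseMass F α δ x y) := by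
    intro δ₁ δ₂ h
    refine iInf_mono fun n => iInf_mono fun p => iInf_mono fun _ => ?_
    exact le_iInf fun hp => iInf_le _ (fun i hi => (hp i hi).trans h)
  have h := hanti.tendsto_nhdsGT 0
  rwa [sSup_image] at h

/-- The integral staircase function `S_F^α` with base point `l`. -/
def staircase (F : Set ℝ) (α l x : ℝ) : ℝ :=
  if l ≤ x then (mass F α l x).toReal else -(mass F α x l).toReal

/-- The upper `F^α`-sum of `h`: the supremum of `h` over `F ∩ [p i, p (i + 1)]` (`0` if that set is
empty) times the increment of the staircase function, summed over the pieces. -/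
def upperSum (F : Set ℝ) (α l : ℝ) (h : ℝ → ℝ) (n : ℕ) (p : ℕ → ℝ) : ℝ :=
  ∑ i ∈ Finset.range n, sSup (h '' (F ∩ Set.Icc (p i) (p (i + 1)))) *
    (staircase F α l (p (i + 1)) - staircase F α l (p i))

/-- The lower `F^α`-sum of `h`, with infima in place of suprema. -/
def lowerSum (F : Set ℝ) (α l : ℝ) (h : ℝ → ℝ) (n : ℕ) (p : ℕ → ℝ) : ℝ :=
  ∑ i ∈ Finset.range n, sInf (h '' (F ∩ Set.Icc (p i) (p (i + 1)))) *
    (staircase F α l (p (i + 1)) - staircase F α l (p i))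

/-- The upper `F^α`-integral of `h` over `[a, b]`. -/
def upperIntegral (F : Set ℝ) (α l : ℝ) (h : ℝ → ℝ) (a b : ℝ) : ℝ :=
  sInf {u | ∃ n p, IsSubdivision a b n p ∧ upperSum F α l h n p = u}

/-- The lower `F^α`-integral of `h` over `[a, b]`. -/
def lowerIntegral (F : Set ℝ) (α l : ℝ) (h : ℝ → ℝ) (a b : ℝ) : ℝ :=
  sSup {u | ∃ n p, IsSubdivision a b n p ∧ lowerSum F α l h n p = u}

/-- `h` is `F^α`-integrable over `[a, b]`: it is bounded on `F ∩ [a, b]`, and its lower and upper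
`F^α`-integrals coincide. -/
def Integrable (F : Set ℝ) (α l : ℝ) (h : ℝ → ℝ) (a b : ℝ) : Prop :=
  (∃ C, ∀ x ∈ F ∩ Set.Icc a b, |h x| ≤ C) ∧ lowerIntegral F α l h a b = upperIntegral F α l h a b

/-- The `F^α`-integral `∫_a^b h(t) d_F^α t` of an `F^α`-integrable function: the common value of the
lower and the upper integral. -/
def integral (F : Set ℝ) (α l : ℝ) (h : ℝ → ℝ) (a b : ℝ) : ℝ := upperIntegral F α l h a b

/-- The improper integral `∫_0^∞ h(t) d_F^α t` exists: `h` is `F^α`-integrable over every `[0, b]`,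
and `∫_0^b h(t) d_F^α t` converges as `b → ∞`. -/
def ImproperIntegrable (F : Set ℝ) (α l : ℝ) (h : ℝ → ℝ) : Prop :=
  (∀ b, 0 ≤ b → Integrable F α l h 0 b) ∧ ∃ I, Tendsto (fun b => integral F α l h 0 b) atTop (𝓝 I)

/-- The improper integral `∫_0^∞ h(t) d_F^α t`. -/
def improperIntegral (F : Set ℝ) (α l : ℝ) (h : ℝ → ℝ) : ℝ :=
  limUnder atTop (fun b => integral F α l h 0 b)

/-- The integrand `e^{-S_F^α(t) / S_F^α(v)} h(t)` of the fractal Sumudu transform. -/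
def sumuduIntegrand (F : Set ℝ) (α l : ℝ) (h : ℝ → ℝ) (v t : ℝ) : ℝ :=
  Real.exp (-(staircase F α l t / staircase F α l v)) * h t

/-- The integral defining the fractal Sumudu transform of `h` at `v` exists. -/
def SumuduExists (F : Set ℝ) (α l : ℝ) (h : ℝ → ℝ) (v : ℝ) : Prop :=
  ImproperIntegrable F α l (sumuduIntegrand F α l h v)

/-- The integral defining the fractal Sumudu transform of `h` at `v` converges absolutely. -/
def SumuduExistsAbs (F : Set ℝ) (α l : ℝ) (h : ℝ → ℝ) (v : ℝ) : Prop :=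
  SumuduExists F α l h v ∧ ImproperIntegrable F α l (fun t => |sumuduIntegrand F α l h v t|)

/-- The fractal Sumudu transform of a function `h` of `t`, at `v`. -/
def sumudu (F : Set ℝ) (α l : ℝ) (h : ℝ → ℝ) (v : ℝ) : ℝ :=
  1 / staircase F α l v * improperIntegral F α l (sumuduIntegrand F α l h v)

/-- The integrand `e^{-S_F^α(v) S_F^α(t)} h(t)` of the fractal Laplace transform. -/
def laplaceIntegrand (F : Set ℝ) (α l : ℝ) (h : ℝ → ℝ) (v t : ℝ) : ℝ :=
  Real.exp (-(staircase F α l v * staircase F α l t)) * h t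

/-- The integral defining the fractal Laplace transform of `h` at `v` exists. -/
def LaplaceExists (F : Set ℝ) (α l : ℝ) (h : ℝ → ℝ) (v : ℝ) : Prop :=
  ImproperIntegrable F α l (laplaceIntegrand F α l h v)

/-- The integral defining the fractal Laplace transform of `h` at `v` converges absolutely. -/
def LaplaceExistsAbs (F : Set ℝ) (α l : ℝ) (h : ℝ → ℝ) (v : ℝ) : Prop :=
  LaplaceExists F α l h v ∧ ImproperIntegrable F α l (fun t => |laplaceIntegrand F α l h v t|)

/-- The fractal Laplace transform of a function `h` of `t`, at `v`. -/
def laplace (F : Set ℝ) (α l : ℝ) (h : ℝ → ℝ) (v : ℝ) : ℝ :=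
  improperIntegral F α l (laplaceIntegrand F α l h v)

/-- The function `t ↦ f(S_F^α(t))`. -/
def onFractal (F : Set ℝ) (α l : ℝ) (f : ℝ → ℝ) (t : ℝ) : ℝ := f (staircase F α l t)

/-- The integrand `z ↦ f(S_F^α(t) - S_F^α(z)) g(S_F^α(z))` of the fractal convolution. -/
def convIntegrand (F : Set ℝ) (α l : ℝ) (f g : ℝ → ℝ) (t z : ℝ) : ℝ :=
  f (staircase F α l t - staircase F α l z) * g (staircase F α l z)

/-- The fractal convolution, as the function `t ↦ (f ∗ g)(S_F^α(t))`. -/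
def conv (F : Set ℝ) (α l : ℝ) (f g : ℝ → ℝ) (t : ℝ) : ℝ :=
  integral F α l (convIntegrand F α l f g t) 0 t

end

end FractalCalculus

/-
The staircase function `S` is continuous, nondecreasing, and constant on every interval that
misses `F`; hence it maps `F ∩ [u, w]` onto `[S u, S w]` whenever `S u < S w`. The `F^α`-sums of
`φ ∘ S` are therefore Darboux sums of `φ`, and the substitution `s = S(t)` turns `F^α`-integrals
into Riemann integrals, and the transforms into the classical Laplace integrals at `p = S(v)` and
`p = 1 / S(v)`. Multiplication by `e^{-p s}` commutes with convolution, so what remains is a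
statement about `D = φ ∗ ψ` for conditionally convergent integrals of `φ` and `ψ` over the
half-line. With primitives `Φ` and `Ψ`, the Cesàro means of `∫_0^x D` are `x⁻¹ (1 ∗ D ∗ 1)(x) =
x⁻¹ (Φ ∗ Ψ)(x)`, which converge to `Φ(∞) Ψ(∞)` (Abel); if `φ` is absolutely integrable, `∫_0^x D =
(φ ∗ Ψ)(x)` itself converges by dominated convergence (Mertens).
-/

namespace FractalCalculus

open MeasureTheory Set

/-- The contribution `Θ(F, [x, y]) (y - x)^α / Γ(α + 1)` of the piece `[x, y]` to a sum
`σ^α[F, P]`. -/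
noncomputable def flagTerm (F : Set ℝ) (α x y : ℝ) : ℝ :=
  (y - x) ^ α / Real.Gamma (α + 1) * flag F x y

section Mass

variable {F : Set ℝ} {α : ℝ}

theorem flag_nonneg (F : Set ℝ) (x y : ℝ) : 0 ≤ flag F x y := by
  unfold flag; split_ifs <;> norm_num

theorem flag_le_one (F : Set ℝ) (x y : ℝ) : flag F x y ≤ 1 := by
  unfold flag; split_ifs <;> norm_num

theorem flag_eq_zero {x y : ℝ} (h : F ∩ Icc x y = ∅) : flag F x y = 0 :=
  if_neg (not_nonempty_iff_eq_empty.2 h)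

theorem rpow_div_Gamma_nonneg (hα : 0 < α) {δ : ℝ} (hδ : 0 ≤ δ) :
    0 ≤ δ ^ α / Real.Gamma (α + 1) :=
  div_nonneg (Real.rpow_nonneg hδ α) (Real.Gamma_pos_of_pos (by linarith)).le

theorem rpow_div_Gamma_le (hα : 0 < α) {δ ε : ℝ} (hδ : 0 ≤ δ) (hε : δ ≤ ε) :
    δ ^ α / Real.Gamma (α + 1) ≤ ε ^ α / Real.Gamma (α + 1) :=
  div_le_div_of_nonneg_right (Real.rpow_le_rpow hδ hε hα.le)
    (Real.Gamma_pos_of_pos (by linarith)).le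

theorem tendsto_rpow_div_Gamma (hα : 0 < α) :
    Tendsto (fun δ : ℝ => δ ^ α / Real.Gamma (α + 1)) (𝓝 0) (𝓝 0) := by
  simpa [Real.zero_rpow hα.ne'] using
    (Real.continuousAt_rpow_const 0 α (Or.inr hα.le)).tendsto.div_const (Real.Gamma (α + 1))

theorem flagTerm_nonneg (F : Set ℝ) (hα : 0 < α) {x y : ℝ} (h : x ≤ y) : 0 ≤ flagTerm F α x y :=
  mul_nonneg (rpow_div_Gamma_nonneg hα (sub_nonneg.2 h)) (flag_nonneg F x y)

theorem flagTerm_self (F : Set ℝ) (hα : 0 < α) (x : ℝ) : flagTerm F α x x = 0 := by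
  simp [flagTerm, Real.zero_rpow hα.ne']

theorem flagTerm_le (F : Set ℝ) (hα : 0 < α) {x y δ : ℝ} (h : x ≤ y) (hδ : y - x ≤ δ) :
    flagTerm F α x y ≤ δ ^ α / Real.Gamma (α + 1) :=
  (mul_le_of_le_one_right (rpow_div_Gamma_nonneg hα (sub_nonneg.2 h)) (flag_le_one F x y)).trans
    (rpow_div_Gamma_le hα (sub_nonneg.2 h) hδ)

theorem flagSum_nonneg (F : Set ℝ) (hα : 0 < α) {n : ℕ} {p : ℕ → ℝ}
    (hp : ∀ i < n, p i ≤ p (i + 1)) : 0 ≤ flagSum F α n p :=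
  Finset.sum_nonneg fun i hi => flagTerm_nonneg F hα (hp i (Finset.mem_range.1 hi))

theorem coarseMass_le_mass (F : Set ℝ) (α x y : ℝ) {δ : ℝ} (hδ : 0 < δ) :
    coarseMass F α δ x y ≤ mass F α x y :=
  le_iSup₂ (f := fun δ (_ : 0 < δ) => coarseMass F α δ x y) δ hδ

theorem coarseMass_le_ofReal_flagSum {δ x y : ℝ} {n : ℕ} {p : ℕ → ℝ}
    (hp : IsSubdivision x y n p) (hmesh : ∀ i < n, p (i + 1) - p i ≤ δ) :
    coarseMass F α δ x y ≤ ENNReal.ofReal (flagSum F α n p) :=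
  iInf₂_le_of_le n p <| iInf₂_le hp hmesh

theorem isSubdivision_endpoints {x y : ℝ} (h : x ≤ y) :
    IsSubdivision x y 1 (fun i => if i = 0 then x else y) := by
  simpa [IsSubdivision] using h

theorem coarseMass_le_ofReal_flagTerm (F : Set ℝ) (α : ℝ) {δ x y : ℝ} (h : x ≤ y)
    (hδ : y - x ≤ δ) : coarseMass F α δ x y ≤ ENNReal.ofReal (flagTerm F α x y) := by
  simpa [flagSum, flagTerm] using
    coarseMass_le_ofReal_flagSum (F := F) (α := α) (isSubdivision_endpoints h) (by simpa using hδ)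

/-- The subdivision that runs through the first `n` pieces of `p` and continues along `q`. -/
def concat (n : ℕ) (p q : ℕ → ℝ) (i : ℕ) : ℝ := if i ≤ n then p i else q (i - n)

theorem concat_of_le {n i : ℕ} (p q : ℕ → ℝ) (hi : i ≤ n) : concat n p q i = p i := if_pos hi

theorem concat_add {n : ℕ} {p q : ℕ → ℝ} (h : p n = q 0) (i : ℕ) : concat n p q (n + i) = q i := by
  rcases Nat.eq_zero_or_pos i with rfl | hi
  · rw [add_zero, concat_of_le p q le_rfl, h]
  · simp [concat, hi.ne']

theorem forall_concat {n m : ℕ} {p q : ℕ → ℝ} (h : p n = q 0) {P : ℝ → ℝ → Prop}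
    (hp : ∀ i < n, P (p i) (p (i + 1))) (hq : ∀ i < m, P (q i) (q (i + 1))) :
    ∀ i < n + m, P (concat n p q i) (concat n p q (i + 1)) := by
  intro i hi
  rcases lt_or_ge i n with hin | hni
  · rw [concat_of_le p q hin.le, concat_of_le p q hin]
    exact hp i hin
  · obtain ⟨j, rfl⟩ := Nat.exists_eq_add_of_le hni
    rw [add_assoc, concat_add h, concat_add h]
    exact hq j (by lia)

theorem IsSubdivision.concat {x y z : ℝ} {n m : ℕ} {p q : ℕ → ℝ} (hp : IsSubdivision x y n p)
    (hq : IsSubdivision y z m q) : IsSubdivision x z (n + m) (concat n p q) := by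
  have h : p n = q 0 := hp.2.1.trans hq.1.symm
  exact ⟨(concat_of_le p q n.zero_le).trans hp.1, (concat_add h m).trans hq.2.1,
    forall_concat h hp.2.2 hq.2.2⟩

theorem flagSum_concat (F : Set ℝ) (α : ℝ) {n : ℕ} (m : ℕ) {p q : ℕ → ℝ} (h : p n = q 0) :
    flagSum F α (n + m) (concat n p q) = flagSum F α n p + flagSum F α m q := by
  unfold flagSum
  rw [Finset.sum_range_add]
  congr 1
  · refine Finset.sum_congr rfl fun i hi => ?_
    have hin := Finset.mem_range.1 hi
    rw [concat_of_le p q hin.le, concat_of_le p q hin]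
  · simp only [add_assoc, concat_add h]

theorem coarseMass_le_add (F : Set ℝ) (hα : 0 < α) (δ x y z : ℝ) :
    coarseMass F α δ x z ≤ coarseMass F α δ x y + coarseMass F α δ y z := by
  conv_rhs => unfold coarseMass
  simp only [ENNReal.iInf_add, ENNReal.add_iInf]
  refine le_iInf₂ fun m q => le_iInf₂ fun hq hqδ => le_iInf₂ fun n p => le_iInf₂ fun hp hpδ => ?_
  have h : p n = q 0 := hp.2.1.trans hq.1.symm
  rw [← ENNReal.ofReal_add (flagSum_nonneg F hα hp.2.2) (flagSum_nonneg F hα hq.2.2),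
    ← flagSum_concat F α m h]
  exact coarseMass_le_ofReal_flagSum (hp.concat hq)
    (forall_concat (P := fun a b => b - a ≤ δ) h hpδ hqδ)

theorem IsSubdivision.min_const {x y z : ℝ} {n : ℕ} {p : ℕ → ℝ} (hp : IsSubdivision x z n p)
    (hxy : x ≤ y) (hyz : y ≤ z) : IsSubdivision x y n (fun i => min (p i) y) :=
  ⟨by simp [hp.1, hxy], by simp [hp.2.1, hyz], fun i hi => min_le_min_right _ (hp.2.2 i hi)⟩

theorem IsSubdivision.max_const {x y z : ℝ} {n : ℕ} {p : ℕ → ℝ} (hp : IsSubdivision x z n p)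
    (hxy : x ≤ y) (hyz : y ≤ z) : IsSubdivision y z n (fun i => max (p i) y) :=
  ⟨by simp [hp.1, hxy], by simp [hp.2.1, hyz], fun i hi => max_le_max_right _ (hp.2.2 i hi)⟩

theorem min_sub_min_le {a b : ℝ} (h : a ≤ b) (y : ℝ) : min b y - min a y ≤ b - a := by grind

theorem max_sub_max_le {a b : ℝ} (h : a ≤ b) (y : ℝ) : max b y - max a y ≤ b - a := by grind

-- The only piece that is really cut is the one containing `y`, where the bracket equals `1`.
theorem flagTerm_min_add_flagTerm_max_le (F : Set ℝ) (hα : 0 < α) {a b δ : ℝ} (hab : a ≤ b)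
    (hδ : b - a ≤ δ) (y : ℝ) :
    flagTerm F α (min a y) (min b y) + flagTerm F α (max a y) (max b y) ≤
      flagTerm F α a b + 2 * (δ ^ α / Real.Gamma (α + 1)) *
        ((if a < y then 1 else 0) - (if b < y then 1 else 0)) := by
  rcases le_or_gt y a with hya | hay
  · simp [hya, hya.trans hab, flagTerm_self F hα, not_lt.2]
  rcases lt_or_ge b y with hby | hyb
  · simp [hay, hby, hay.le, hby.le, flagTerm_self F hα]
  · have hleft := flagTerm_le F hα hay.le (show y - a ≤ δ by linarith)
    have hright := flagTerm_le F hα hyb (show b - y ≤ δ by linarith)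
    have hnonneg := flagTerm_nonneg F hα hab
    simp only [min_eq_left hay.le, min_eq_right hyb, max_eq_right hay.le, max_eq_left hyb, hay,
      not_lt.2 hyb, if_true, if_false]
    linarith

theorem flagSum_min_add_flagSum_max_le (F : Set ℝ) (hα : 0 < α) {δ : ℝ} (hδ : 0 ≤ δ)
    {n : ℕ} {p : ℕ → ℝ} (hp : ∀ i < n, p i ≤ p (i + 1)) (hpδ : ∀ i < n, p (i + 1) - p i ≤ δ)
    (y : ℝ) :
    flagSum F α n (fun i => min (p i) y) + flagSum F α n (fun i => max (p i) y) ≤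
      flagSum F α n p + 2 * (δ ^ α / Real.Gamma (α + 1)) := by
  have htelescope : ∑ i ∈ Finset.range n,
      ((if p i < y then (1 : ℝ) else 0) - (if p (i + 1) < y then 1 else 0)) ≤ 1 := by
    rw [Finset.sum_range_sub' (fun i => if p i < y then (1 : ℝ) else 0)]
    split_ifs <;> norm_num
  calc flagSum F α n (fun i => min (p i) y) + flagSum F α n (fun i => max (p i) y)
      = ∑ i ∈ Finset.range n, (flagTerm F α (min (p i) y) (min (p (i + 1)) y) +
          flagTerm F α (max (p i) y) (max (p (i + 1)) y)) := Finset.sum_add_distrib.symm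
    _ ≤ ∑ i ∈ Finset.range n, (flagTerm F α (p i) (p (i + 1)) +
          2 * (δ ^ α / Real.Gamma (α + 1)) *
            ((if p i < y then 1 else 0) - (if p (i + 1) < y then 1 else 0))) :=
        Finset.sum_le_sum fun i hi => flagTerm_min_add_flagTerm_max_le F hα
          (hp i (Finset.mem_range.1 hi)) (hpδ i (Finset.mem_range.1 hi)) y
    _ ≤ flagSum F α n p + 2 * (δ ^ α / Real.Gamma (α + 1)) := by
        rw [Finset.sum_add_distrib, ← Finset.mul_sum]
        exact add_le_add le_rfl (mul_le_of_le_one_right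
          (mul_nonneg zero_le_two (rpow_div_Gamma_nonneg hα hδ)) htelescope)

theorem coarseMass_add_coarseMass_le (F : Set ℝ) (hα : 0 < α) {δ x y z : ℝ} (hδ : 0 ≤ δ)
    (hxy : x ≤ y) (hyz : y ≤ z) :
    coarseMass F α δ x y + coarseMass F α δ y z ≤
      coarseMass F α δ x z + ENNReal.ofReal (2 * (δ ^ α / Real.Gamma (α + 1))) := by
  conv_rhs => unfold coarseMass
  simp only [ENNReal.iInf_add]
  refine le_iInf₂ fun n p => le_iInf₂ fun hp hpδ => ?_
  have hmin := hp.min_const hxy hyz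
  have hmax := hp.max_const hxy hyz
  calc coarseMass F α δ x y + coarseMass F α δ y z
      ≤ ENNReal.ofReal (flagSum F α n fun i => min (p i) y) +
          ENNReal.ofReal (flagSum F α n fun i => max (p i) y) :=
        add_le_add
          (coarseMass_le_ofReal_flagSum hmin fun i hi =>
            (min_sub_min_le (hp.2.2 i hi) y).trans (hpδ i hi))
          (coarseMass_le_ofReal_flagSum hmax fun i hi =>
            (max_sub_max_le (hp.2.2 i hi) y).trans (hpδ i hi))
    _ ≤ ENNReal.ofReal (flagSum F α n p) +
          ENNReal.ofReal (2 * (δ ^ α / Real.Gamma (α + 1))) := by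
        rw [← ENNReal.ofReal_add (flagSum_nonneg F hα hmin.2.2) (flagSum_nonneg F hα hmax.2.2),
          ← ENNReal.ofReal_add (flagSum_nonneg F hα hp.2.2)
            (mul_nonneg zero_le_two (rpow_div_Gamma_nonneg hα hδ))]
        exact ENNReal.ofReal_le_ofReal (flagSum_min_add_flagSum_max_le F hα hδ hp.2.2 hpδ y)

theorem mass_add (F : Set ℝ) (hα : 0 < α) {x y z : ℝ} (hxy : x ≤ y) (hyz : y ≤ z) :
    mass F α x y + mass F α y z = mass F α x z := by
  have hsum := (tendsto_coarseMass F α x y).add (tendsto_coarseMass F α y z)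
  have hwhole := tendsto_coarseMass F α x z
  have herror : Tendsto (fun δ : ℝ => ENNReal.ofReal (2 * (δ ^ α / Real.Gamma (α + 1))))
      (𝓝[>] 0) (𝓝 0) := by
    simpa using ENNReal.tendsto_ofReal
      (((tendsto_rpow_div_Gamma hα).const_mul 2).mono_left nhdsWithin_le_nhds)
  refine le_antisymm (le_of_tendsto_of_tendsto hsum
    (by simpa only [add_zero] using hwhole.add herror) ?_)
    (le_of_tendsto_of_tendsto' hwhole hsum fun δ => coarseMass_le_add F hα δ x y z)
  filter_upwards [self_mem_nhdsWithin] with δ hδ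
  exact coarseMass_add_coarseMass_le F hα (le_of_lt hδ) hxy hyz

end Mass

section Subdivision

variable {x y : ℝ} {n : ℕ} {p : ℕ → ℝ}

theorem IsSubdivision.monotone (hp : IsSubdivision x y n p) {i j : ℕ} (hij : i ≤ j)
    (hj : j ≤ n) : p i ≤ p j := by
  induction j, hij using Nat.le_induction with
  | base => exact le_rfl
  | succ j _ ih => exact (ih (by lia)).trans (hp.2.2 j (by lia))

theorem IsSubdivision.mem_Icc (hp : IsSubdivision x y n p) {i : ℕ} (hi : i ≤ n) :
    p i ∈ Icc x y :=
  ⟨hp.1 ▸ hp.monotone i.zero_le hi, hp.2.1 ▸ hp.monotone hi le_rfl⟩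

theorem IsSubdivision.Icc_subset (hp : IsSubdivision x y n p) {i : ℕ} (hi : i < n) :
    Icc (p i) (p (i + 1)) ⊆ Icc x y :=
  Icc_subset_Icc (hp.mem_Icc hi.le).1 (hp.mem_Icc hi).2

theorem IsSubdivision.comp {S : ℝ → ℝ} (hp : IsSubdivision x y n p) (hS : Monotone S) :
    IsSubdivision (S x) (S y) n (S ∘ p) :=
  ⟨congrArg S hp.1, congrArg S hp.2.1, fun i hi => hS (hp.2.2 i hi)⟩

/-- The points of the subdivision of `[a, b]` into `N + 1` pieces of equal length. -/
noncomputable def uniformSubdivision (a b : ℝ) (N i : ℕ) : ℝ := a + i * ((b - a) / (N + 1))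

theorem uniformSubdivision_succ_sub (a b : ℝ) (N i : ℕ) :
    uniformSubdivision a b N (i + 1) - uniformSubdivision a b N i = (b - a) / (N + 1) := by
  simp only [uniformSubdivision]
  push_cast
  ring

theorem isSubdivision_uniformSubdivision (h : x ≤ y) (N : ℕ) :
    IsSubdivision x y (N + 1) (uniformSubdivision x y N) := by
  refine ⟨by simp [uniformSubdivision], ?_, fun i _ => ?_⟩
  · have hN : (N : ℝ) + 1 ≠ 0 := by positivity
    simp only [uniformSubdivision]
    push_cast
    field_simp
    ring
  · rw [← sub_nonneg, uniformSubdivision_succ_sub]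
    exact div_nonneg (sub_nonneg.2 h) (by positivity)

/-- The meshes of the subdivisions `q N 0, …, q N (n N)` tend to `0` as `N → ∞`. -/
def MeshTendstoZero (n : ℕ → ℕ) (q : ℕ → ℕ → ℝ) : Prop :=
  ∀ δ > 0, ∀ᶠ N in atTop, ∀ i < n N, q N (i + 1) - q N i < δ

theorem meshTendstoZero_uniformSubdivision (a b : ℝ) :
    MeshTendstoZero (· + 1) (uniformSubdivision a b) := by
  intro δ hδ
  have hlim : Tendsto (fun N : ℕ => (b - a) / ((N : ℝ) + 1)) atTop (𝓝 0) :=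
    tendsto_const_nhds.div_atTop (tendsto_natCast_atTop_atTop.atTop_add tendsto_const_nhds)
  filter_upwards [hlim.eventually_lt_const hδ] with N hN i _
  rwa [uniformSubdivision_succ_sub]

theorem MeshTendstoZero.comp {S : ℝ → ℝ} (hmono : Monotone S) (hcont : Continuous S) {a b : ℝ}
    {n : ℕ → ℕ} {q : ℕ → ℕ → ℝ} (hq : ∀ N, IsSubdivision a b (n N) (q N))
    (h : MeshTendstoZero n q) : MeshTendstoZero n (fun N => S ∘ q N) := by
  intro ε hε
  obtain ⟨δ, hδ, hS⟩ := Metric.uniformContinuousOn_iff.1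
    (isCompact_Icc.uniformContinuousOn_of_continuous (hcont.continuousOn (s := Icc a b))) ε hε
  filter_upwards [h δ hδ] with N hN i hi
  have hle := (hq N).2.2 i hi
  have hdist := hS _ ((hq N).mem_Icc hi) _ ((hq N).mem_Icc hi.le)
    (by rw [Real.dist_eq, abs_of_nonneg (sub_nonneg.2 hle)]; exact hN i hi)
  rwa [Real.dist_eq, abs_of_nonneg (sub_nonneg.2 (hmono hle))] at hdist

end Subdivision

/-- `S` is a continuous nondecreasing function that is constant on every interval disjoint
from `F`. These are the only properties of the staircase function used by the integration theory
below. -/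
structure IsStaircase (F : Set ℝ) (S : ℝ → ℝ) : Prop where
  monotone : Monotone S
  continuous : Continuous S
  eq_of_disjoint : ∀ {x y : ℝ}, x ≤ y → F ∩ Icc x y = ∅ → S x = S y

section Staircase

variable {F : Set ℝ} {α : ℝ}

theorem mass_eq_zero_of_disjoint (α : ℝ) {x y : ℝ} (h : x ≤ y) (hF : F ∩ Icc x y = ∅) :
    mass F α x y = 0 := by
  refine le_antisymm (iSup₂_le fun δ hδ => ?_) bot_le
  obtain ⟨N, hN⟩ := (meshTendstoZero_uniformSubdivision x y δ hδ).exists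
  have hp := isSubdivision_uniformSubdivision h N
  have hflagSum : flagSum F α (N + 1) (uniformSubdivision x y N) = 0 := by
    refine Finset.sum_eq_zero fun i hi => ?_
    rw [flag_eq_zero (subset_empty_iff.1 (hF ▸ inter_subset_inter_right F
      (hp.Icc_subset (Finset.mem_range.1 hi)))), mul_zero]
  simpa [hflagSum] using
    coarseMass_le_ofReal_flagSum (F := F) (α := α) hp fun i hi => (hN i hi).le

theorem mass_add_coarseMass_le (F : Set ℝ) (hα : 0 < α) {a b u w δ : ℝ} (hau : a ≤ u)
    (huw : u ≤ w) (hwb : w ≤ b) (hδ : 0 < δ) (hshort : w - u ≤ δ) :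
    mass F α u w + coarseMass F α δ a b ≤
      mass F α a b + ENNReal.ofReal (flagTerm F α u w) := by
  have hcoarse : coarseMass F α δ a b ≤
      mass F α a u + (ENNReal.ofReal (flagTerm F α u w) + mass F α w b) :=
    calc coarseMass F α δ a b
        ≤ coarseMass F α δ a u + (coarseMass F α δ u w + coarseMass F α δ w b) :=
          (coarseMass_le_add F hα δ a u b).trans
            (add_le_add le_rfl (coarseMass_le_add F hα δ u w b))
      _ ≤ mass F α a u + (ENNReal.ofReal (flagTerm F α u w) + mass F α w b) := by
          gcongr
          · exact coarseMass_le_mass F α a u hδ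
          · exact coarseMass_le_ofReal_flagTerm F α huw hshort
          · exact coarseMass_le_mass F α w b hδ
  rw [← mass_add F hα hau (huw.trans hwb), ← mass_add F hα huw hwb]
  refine (add_le_add le_rfl hcoarse).trans (le_of_eq ?_)
  ring

theorem exists_forall_mass_lt (hα : 0 < α) {a b : ℝ} (hab : mass F α a b ≠ ⊤) {ε : ℝ≥0∞}
    (hε : ε ≠ 0) :
    ∃ η > 0, ∀ u w, a ≤ u → u ≤ w → w ≤ b → w - u < η → mass F α u w < ε := by
  have hε2 : ε / 2 ≠ 0 := ENNReal.half_pos hε |>.ne'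
  obtain ⟨δ, hδε, hδ⟩ : ∃ δ, mass F α a b < coarseMass F α δ a b + ε / 2 ∧ 0 < δ :=
    ((((tendsto_coarseMass F α a b).add_const (ε / 2)).eventually_const_lt
      (ENNReal.lt_add_right hab hε2)).and self_mem_nhdsWithin).exists
  have hlim : Tendsto (fun r : ℝ => ENNReal.ofReal (r ^ α / Real.Gamma (α + 1))) (𝓝 0) (𝓝 0) := by
    simpa using ENNReal.tendsto_ofReal (tendsto_rpow_div_Gamma hα)
  obtain ⟨η, hη, hηε⟩ := Metric.eventually_nhds_iff.1
    (hlim.eventually_lt_const (pos_iff_ne_zero.2 hε2))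
  refine ⟨min δ η, lt_min hδ hη, fun u w hau huw hwb hwu => ?_⟩
  have hterm : ENNReal.ofReal (flagTerm F α u w) < ε / 2 := by
    refine (ENNReal.ofReal_le_ofReal (flagTerm_le F hα huw le_rfl)).trans_lt (hηε ?_)
    rw [Real.dist_0_eq_abs, abs_of_nonneg (sub_nonneg.2 huw)]
    exact hwu.trans_le (min_le_right δ η)
  refine lt_of_add_lt_add_right (a := coarseMass F α δ a b) ?_
  calc mass F α u w + coarseMass F α δ a b
      ≤ mass F α a b + ENNReal.ofReal (flagTerm F α u w) :=
        mass_add_coarseMass_le F hα hau huw hwb hδ (hwu.le.trans (min_le_left δ η))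
    _ < coarseMass F α δ a b + ε / 2 + ε / 2 := ENNReal.add_lt_add hδε hterm
    _ = ε + coarseMass F α δ a b := by rw [add_assoc, ENNReal.add_halves, add_comm]

variable (hα : 0 < α) (l : ℝ) (hfin : ∀ x y : ℝ, x ≤ y → mass F α x y ≠ ⊤)
include hα hfin

theorem staircase_sub {x y : ℝ} (h : x ≤ y) :
    staircase F α l y - staircase F α l x = (mass F α x y).toReal := by
  have hadd {a b c : ℝ} (hab : a ≤ b) (hbc : b ≤ c) :
      (mass F α a c).toReal = (mass F α a b).toReal + (mass F α b c).toReal := by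
    rw [← mass_add F hα hab hbc, ENNReal.toReal_add (hfin _ _ hab) (hfin _ _ hbc)]
  unfold staircase
  split_ifs with hly hlx hlx
  · rw [hadd hlx h]; ring
  · rw [hadd (not_le.1 hlx).le hly]; ring
  · exact absurd (hlx.trans h) hly
  · rw [hadd h (not_le.1 hly).le]; ring

theorem dist_staircase (x y : ℝ) :
    dist (staircase F α l x) (staircase F α l y) = (mass F α (min x y) (max x y)).toReal := by
  wlog h : x ≤ y generalizing x y
  · rw [dist_comm, min_comm, max_comm, this y x (le_of_not_ge h)]
  rw [dist_comm, Real.dist_eq, staircase_sub hα l hfin h, min_eq_left h, max_eq_right h,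
    abs_of_nonneg ENNReal.toReal_nonneg]

theorem continuous_staircase : Continuous (staircase F α l) := by
  refine Metric.continuous_iff.2 fun x ε hε => ?_
  obtain ⟨η, hη, hsmall⟩ := exists_forall_mass_lt hα (hfin (x - 1) (x + 1) (by linarith))
    (ENNReal.ofReal_pos.2 hε).ne'
  refine ⟨min 1 η, lt_min one_pos hη, fun y hy => ?_⟩
  obtain ⟨hy1, hyη⟩ := lt_min_iff.1 hy
  rw [Real.dist_eq] at hy1 hyη
  obtain ⟨hxy, hyx⟩ := abs_lt.1 hy1
  rw [dist_staircase hα l hfin]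
  refine ENNReal.toReal_lt_of_lt_ofReal (hsmall _ _ ?_ min_le_max ?_ ?_)
  · exact le_min (by linarith) (by linarith)
  · exact max_le (by linarith) (by linarith)
  · rwa [max_sub_min_eq_abs, abs_sub_comm]

theorem isStaircase_staircase : IsStaircase F (staircase F α l) where
  monotone x y h := sub_nonneg.1 (staircase_sub hα l hfin h ▸ ENNReal.toReal_nonneg)
  continuous := continuous_staircase hα l hfin
  eq_of_disjoint {x y} h hF := by
    have hsub := staircase_sub hα l hfin h
    rw [mass_eq_zero_of_disjoint α h hF, ENNReal.toReal_zero] at hsub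
    linarith

end Staircase

namespace IsStaircase

variable {F : Set ℝ} {S : ℝ → ℝ} {u w : ℝ}

theorem nonempty_inter (hS : IsStaircase F S) (huw : S u < S w) : (F ∩ Icc u w).Nonempty := by
  by_contra hempty
  exact huw.ne (hS.eq_of_disjoint (hS.monotone.reflect_lt huw).le
    (not_nonempty_iff_eq_empty.1 hempty))

theorem Ioc_subset_closure_image (hS : IsStaircase F S) :
    Ioc (S u) (S w) ⊆ closure (S '' (F ∩ Icc u w)) := by
  rintro s ⟨hus, hsw⟩
  have huw : u ≤ w := (hS.monotone.reflect_lt (hus.trans_le hsw)).le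
  obtain ⟨y, hy, rfl⟩ := intermediate_value_Icc huw hS.continuous.continuousOn ⟨hus.le, hsw⟩
  refine mem_closure_iff_nhds_basis Metric.nhds_basis_closedBall |>.2 fun ε hε => ?_
  obtain ⟨x, hx, hSx⟩ := intermediate_value_Icc hy.1 hS.continuous.continuousOn
    (show max (S u) (S y - ε) ∈ Icc (S u) (S y) from
      ⟨le_max_left _ _, max_le hus.le (by linarith)⟩)
  have hxy : S x < S y := hSx ▸ max_lt hus (by linarith)
  obtain ⟨z, hzF, hz⟩ := hS.nonempty_inter hxy
  refine ⟨S z, ⟨z, ⟨hzF, hx.1.trans hz.1, hz.2.trans hy.2⟩, rfl⟩, ?_⟩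
  have hSxz := hS.monotone hz.1
  have hSzy := hS.monotone hz.2
  have hε_le := hSx ▸ le_max_right (S u) (S y - ε)
  rw [Metric.mem_closedBall, Real.dist_eq, abs_le]
  constructor <;> linarith

theorem image_inter_Icc (hS : IsStaircase F S) (hF : IsClosed F) (huw : S u < S w) :
    S '' (F ∩ Icc u w) = Icc (S u) (S w) := by
  refine Subset.antisymm ?_ ?_
  · rintro _ ⟨z, ⟨-, hz⟩, rfl⟩
    exact ⟨hS.monotone hz.1, hS.monotone hz.2⟩
  · have hclosed : IsClosed (S '' (F ∩ Icc u w)) :=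
      ((isCompact_Icc.inter_left hF).image hS.continuous).isClosed
    rw [← closure_Ioc huw.ne, ← hclosed.closure_eq]
    exact closure_minimal hS.Ioc_subset_closure_image isClosed_closure

end IsStaircase

/-- The upper Darboux sum of `φ` for the subdivision `q`. The lower Darboux sum is
`-upperDarboux (-φ) n q`. -/
noncomputable def upperDarboux (φ : ℝ → ℝ) (n : ℕ) (q : ℕ → ℝ) : ℝ :=
  ∑ i ∈ Finset.range n, sSup (φ '' Icc (q i) (q (i + 1))) * (q (i + 1) - q i)

/-- The step function whose value on `(q i, q (i + 1)]` is the supremum of `φ` on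
`[q i, q (i + 1)]`. -/
noncomputable def upperStep (φ : ℝ → ℝ) (n : ℕ) (q : ℕ → ℝ) (s : ℝ) : ℝ :=
  ∑ i ∈ Finset.range n,
    (Ioc (q i) (q (i + 1))).indicator (fun _ => sSup (φ '' Icc (q i) (q (i + 1)))) s

/-- Riemann integrability over `[a, b]`, in the form of Lebesgue's criterion: `φ` is bounded, and
continuous almost everywhere. -/
structure RiemannIntegrable (φ : ℝ → ℝ) (a b : ℝ) : Prop where
  bounded : ∃ C, ∀ s ∈ Icc a b, |φ s| ≤ C
  ae_continuousAt : ∀ᵐ s, s ∈ Ioo a b → ContinuousAt φ s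

section Darboux

variable {φ : ℝ → ℝ} {a b C : ℝ} {n : ℕ} {q : ℕ → ℝ}

theorem IsSubdivision.exists_mem_Ioc (hq : IsSubdivision a b n q) {s : ℝ} (hs : s ∈ Ioc a b) :
    ∃ i < n, s ∈ Ioc (q i) (q (i + 1)) := by
  have hn : n ≠ 0 := by
    rintro rfl
    exact (hs.1.trans_le hs.2).ne (hq.1.symm.trans hq.2.1)
  have hstart : ¬(n ≤ 0 ∨ s ≤ q 0) :=
    not_or.2 ⟨fun h => hn (Nat.le_zero.1 h), not_le.2 (hq.1 ▸ hs.1)⟩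
  obtain ⟨i, hi, hsi⟩ := Nat.exists_not_and_succ_of_not_zero_of_exists
    (p := fun i => n ≤ i ∨ s ≤ q i) hstart ⟨n, Or.inl le_rfl⟩
  obtain ⟨hin, his⟩ := not_or.1 hi
  refine ⟨i, not_le.1 hin, not_le.1 his, hsi.elim (fun hni => ?_) id⟩
  rw [show i + 1 = n by lia, hq.2.1]
  exact hs.2

theorem upperStep_eq (hq : IsSubdivision a b n q) (φ : ℝ → ℝ) {s : ℝ} {i : ℕ} (hi : i < n)
    (hs : s ∈ Ioc (q i) (q (i + 1))) : upperStep φ n q s = sSup (φ '' Icc (q i) (q (i + 1))) := by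
  rw [upperStep, Finset.sum_eq_single_of_mem i (Finset.mem_range.2 hi), indicator_of_mem hs]
  intro j hj hji
  refine indicator_of_notMem (fun hsj => ?_) _
  have hjn := Finset.mem_range.1 hj
  rcases lt_or_gt_of_ne hji with hji | hij
  · exact (hsj.2.trans (hq.monotone (Nat.succ_le_of_lt hji) hi.le)).not_gt hs.1
  · exact (hs.2.trans (hq.monotone (Nat.succ_le_of_lt hij) hjn.le)).not_gt hsj.1

theorem upperStep_mem_Icc (hq : IsSubdivision a b n q) (hC : ∀ s ∈ Icc a b, |φ s| ≤ C) {s : ℝ}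
    (hs : s ∈ Ioc a b) : upperStep φ n q s ∈ Icc (φ s) C := by
  obtain ⟨i, hi, hsi⟩ := hq.exists_mem_Ioc hs
  have hle : ∀ y ∈ φ '' Icc (q i) (q (i + 1)), y ≤ C :=
    forall_mem_image.2 fun z hz => (le_abs_self _).trans (hC z (hq.Icc_subset hi hz))
  have hmem := mem_image_of_mem φ (Ioc_subset_Icc_self hsi)
  rw [upperStep_eq hq φ hi hsi]
  exact ⟨le_csSup ⟨C, hle⟩ hmem, csSup_le ⟨_, hmem⟩ hle⟩

theorem abs_upperStep_le (hq : IsSubdivision a b n q) (hC : ∀ s ∈ Icc a b, |φ s| ≤ C) {s : ℝ}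
    (hs : s ∈ Ioc a b) : |upperStep φ n q s| ≤ C := by
  have hmem := upperStep_mem_Icc hq hC hs
  exact abs_le.2 ⟨(abs_le.1 (hC s (Ioc_subset_Icc_self hs))).1.trans hmem.1, hmem.2⟩

theorem integrable_indicator_Ioc_const (c d r : ℝ) :
    MeasureTheory.Integrable ((Ioc c d).indicator fun _ => r) :=
  (integrable_indicator_iff measurableSet_Ioc).2 (integrableOn_const measure_Ioc_lt_top.ne)

theorem integrable_upperStep (φ : ℝ → ℝ) (n : ℕ) (q : ℕ → ℝ) :
    MeasureTheory.Integrable (upperStep φ n q) :=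
  integrable_finsetSum _ fun _ _ => integrable_indicator_Ioc_const _ _ _

theorem setIntegral_upperStep (hq : IsSubdivision a b n q) (φ : ℝ → ℝ) :
    ∫ s in Ioc a b, upperStep φ n q s = upperDarboux φ n q := by
  simp only [upperStep, upperDarboux]
  rw [integral_finsetSum _ fun _ _ => (integrable_indicator_Ioc_const _ _ _).integrableOn]
  refine Finset.sum_congr rfl fun i hi => ?_
  have hin := Finset.mem_range.1 hi
  have hsub : Ioc (q i) (q (i + 1)) ⊆ Ioc a b :=
    Ioc_subset_Ioc (hq.mem_Icc hin.le).1 (hq.mem_Icc hin).2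
  rw [setIntegral_indicator measurableSet_Ioc, inter_eq_self_of_subset_right hsub,
    setIntegral_const, measureReal_def, Real.volume_Ioc,
    ENNReal.toReal_ofReal (sub_nonneg.2 (hq.2.2 i hin)), smul_eq_mul, mul_comm]

theorem eventually_abs_sub_lt_of_upperStep {m : ℕ} {r : ℕ → ℝ} (hq : IsSubdivision a b n q)
    (hr : IsSubdivision a b m r) (hC : ∀ s ∈ Icc a b, |φ s| ≤ C) {x ε : ℝ} (hx : x ∈ Ioc a b)
    (hxq : ∀ i, x ≠ q i) (hxr : ∀ i, x ≠ r i)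
    (hgap : upperStep φ n q x + upperStep (-φ) m r x < ε) :
    ∀ᶠ y in 𝓝 x, |φ y - φ x| < ε := by
  obtain ⟨i, hi, hxi⟩ := hq.exists_mem_Ioc hx
  obtain ⟨j, hj, hxj⟩ := hr.exists_mem_Ioc hx
  have hi_nhds := Icc_mem_nhds hxi.1 (lt_of_le_of_ne hxi.2 (hxq (i + 1)))
  have hj_nhds := Icc_mem_nhds hxj.1 (lt_of_le_of_ne hxj.2 (hxr (j + 1)))
  rw [upperStep_eq hq _ hi hxi, upperStep_eq hr _ hj hxj] at hgap
  have hupper : ∀ y ∈ Icc (q i) (q (i + 1)), φ y ≤ sSup (φ '' Icc (q i) (q (i + 1))) :=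
    fun y hy => le_csSup ⟨C, forall_mem_image.2 fun z hz =>
      (le_abs_self _).trans (hC z (hq.Icc_subset hi hz))⟩ (mem_image_of_mem φ hy)
  have hlower : ∀ y ∈ Icc (r j) (r (j + 1)), -φ y ≤ sSup ((-φ) '' Icc (r j) (r (j + 1))) :=
    fun y hy => le_csSup ⟨C, forall_mem_image.2 fun z hz =>
      (neg_le_abs _).trans (hC z (hr.Icc_subset hj hz))⟩ (mem_image_of_mem (-φ) hy)
  filter_upwards [hi_nhds, hj_nhds] with y hyi hyj
  have hx_upper := hupper x (Ioc_subset_Icc_self hxi)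
  have hx_lower := hlower x (Ioc_subset_Icc_self hxj)
  have hy_upper := hupper y hyi
  have hy_lower := hlower y hyj
  rw [abs_lt]
  constructor <;> linarith

theorem ae_forall_exists_lt_of_integral_lt {ι X : Type*} [Countable ι] [MeasurableSpace X]
    {μ : Measure X} {f : ι → X → ℝ} (hf : ∀ k, MeasureTheory.Integrable (f k) μ)
    (hnonneg : ∀ k, 0 ≤ᵐ[μ] f k) (hsmall : ∀ ε > 0, ∃ k, ∫ x, f k x ∂μ < ε) :
    ∀ᵐ x ∂μ, ∀ ε > 0, ∃ k, f k x < ε := by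
  have hzero : ∫⁻ x, ⨅ k, ENNReal.ofReal (f k x) ∂μ = 0 := by
    refine le_antisymm (ENNReal.le_of_forall_pos_le_add fun ε hε _ => ?_) bot_le
    obtain ⟨k, hk⟩ := hsmall ε hε
    calc ∫⁻ x, ⨅ k, ENNReal.ofReal (f k x) ∂μ
        ≤ ∫⁻ x, ENNReal.ofReal (f k x) ∂μ := lintegral_mono fun x => iInf_le _ k
      _ = ENNReal.ofReal (∫ x, f k x ∂μ) :=
          (ofReal_integral_eq_lintegral_ofReal (hf k) (hnonneg k)).symm
      _ ≤ 0 + ε := by rw [zero_add]; exact ENNReal.ofReal_le_of_le_toReal hk.le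
  have hmeas : AEMeasurable (fun x => ⨅ k, ENNReal.ofReal (f k x)) μ :=
    AEMeasurable.iInf fun k => (hf k).aemeasurable.ennreal_ofReal
  filter_upwards [(lintegral_eq_zero_iff' hmeas).1 hzero] with x hx ε hε
  obtain ⟨k, hk⟩ := iInf_lt_iff.1
    (show ⨅ k, ENNReal.ofReal (f k x) < ENNReal.ofReal ε from hx.trans_lt (ENNReal.ofReal_pos.2 hε))
  exact ⟨k, (ENNReal.ofReal_lt_ofReal_iff hε).1 hk⟩

theorem riemannIntegrable_of_forall_exists_upperDarboux_lt (hC : ∀ s ∈ Icc a b, |φ s| ≤ C)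
    (hDarboux : ∀ ε > 0, ∃ n q m r, IsSubdivision a b n q ∧ IsSubdivision a b m r ∧
      upperDarboux φ n q + upperDarboux (-φ) m r < ε) :
    RiemannIntegrable φ a b := by
  have hC' : ∀ s ∈ Icc a b, |(-φ) s| ≤ C := by simpa using hC
  refine ⟨⟨C, hC⟩, ?_⟩
  choose n q m r hq hr hlt using fun k : ℕ => hDarboux (1 / (k + 1)) (by positivity)
  have hgap : ∀ᵐ x ∂volume.restrict (Ioc a b), ∀ ε > 0, ∃ k,
      upperStep φ (n k) (q k) x + upperStep (-φ) (m k) (r k) x < ε := by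
    refine ae_forall_exists_lt_of_integral_lt (fun k => ((integrable_upperStep _ _ _).add
      (integrable_upperStep _ _ _)).integrableOn) (fun k => ?_) (fun ε hε => ?_)
    · filter_upwards [ae_restrict_mem measurableSet_Ioc] with x hx
      have hupper := (upperStep_mem_Icc (hq k) hC hx).1
      have hlower := (upperStep_mem_Icc (hr k) hC' hx).1
      rw [Pi.neg_apply] at hlower
      change 0 ≤ upperStep φ (n k) (q k) x + upperStep (-φ) (m k) (r k) x
      linarith
    · obtain ⟨k, hk⟩ := exists_nat_one_div_lt hε
      refine ⟨k, lt_of_eq_of_lt ?_ ((hlt k).trans hk)⟩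
      rw [integral_add (integrable_upperStep _ _ _).integrableOn
        (integrable_upperStep _ _ _).integrableOn, setIntegral_upperStep (hq k),
        setIntegral_upperStep (hr k)]
  have hnodes : ∀ᵐ x : ℝ, ∀ k i, x ≠ q k i ∧ x ≠ r k i := by
    simp only [ae_all_iff, eventually_and]
    exact fun k i => ⟨Measure.ae_ne volume _, Measure.ae_ne volume _⟩
  filter_upwards [(ae_restrict_iff' measurableSet_Ioc).1 hgap, hnodes] with x hx hxnode hxab
  have hx' := Ioo_subset_Ioc_self hxab
  refine Metric.tendsto_nhds.2 fun ε hε => ?_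
  obtain ⟨k, hk⟩ := hx hx' ε hε
  exact eventually_abs_sub_lt_of_upperStep (hq k) (hr k) hC hx' (fun i => (hxnode k i).1)
    (fun i => (hxnode k i).2) hk

theorem tendsto_upperStep {n : ℕ → ℕ} {q : ℕ → ℕ → ℝ} (hq : ∀ N, IsSubdivision a b (n N) (q N))
    (hmesh : MeshTendstoZero n q) {s : ℝ} (hs : s ∈ Ioc a b) (hφ : ContinuousAt φ s) :
    Tendsto (fun N => upperStep φ (n N) (q N) s) atTop (𝓝 (φ s)) := by
  refine Metric.nhds_basis_closedBall.tendsto_right_iff.2 fun ε hε => ?_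
  obtain ⟨δ, hδ, hφδ⟩ := Metric.continuousAt_iff.1 hφ ε hε
  filter_upwards [hmesh δ hδ] with N hN
  obtain ⟨i, hi, hsi⟩ := (hq N).exists_mem_Ioc hs
  have hnear : ∀ y ∈ φ '' Icc (q N i) (q N (i + 1)), y ≤ φ s + ε := by
    refine forall_mem_image.2 fun y hy => ?_
    have hys : dist y s < δ := by
      have := hN i hi
      rw [Real.dist_eq, abs_lt]
      constructor <;> linarith [hy.1, hy.2, hsi.1, hsi.2]
    linarith [(abs_lt.1 (hφδ hys)).2]
  have hmem := mem_image_of_mem φ (Ioc_subset_Icc_self hsi)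
  have hlower := le_csSup ⟨_, hnear⟩ hmem
  have hupper := csSup_le ⟨_, hmem⟩ hnear
  rw [Metric.mem_closedBall, upperStep_eq (hq N) φ hi hsi, Real.dist_eq, abs_le]
  constructor <;> linarith

namespace RiemannIntegrable

theorem ae_restrict_continuousAt (hφ : RiemannIntegrable φ a b) :
    ∀ᵐ s ∂volume.restrict (Ioc a b), ContinuousAt φ s := by
  rw [← restrict_Ioo_eq_restrict_Ioc, ae_restrict_iff' measurableSet_Ioo]
  exact hφ.ae_continuousAt

theorem ae_tendsto_upperStep (hφ : RiemannIntegrable φ a b) {n : ℕ → ℕ} {q : ℕ → ℕ → ℝ}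
    (hq : ∀ N, IsSubdivision a b (n N) (q N)) (hmesh : MeshTendstoZero n q) :
    ∀ᵐ s ∂volume.restrict (Ioc a b),
      Tendsto (fun N => upperStep φ (n N) (q N) s) atTop (𝓝 (φ s)) := by
  filter_upwards [hφ.ae_restrict_continuousAt, ae_restrict_mem measurableSet_Ioc] with s hφs hs
  exact tendsto_upperStep hq hmesh hs hφs

theorem integrableOn (hφ : RiemannIntegrable φ a b) : IntegrableOn φ (Ioc a b) := by
  obtain ⟨C, hC⟩ := hφ.bounded
  rcases le_total b a with hba | hab
  · simp [Ioc_eq_empty_of_le hba]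
  refine IntegrableOn.of_bound measure_Ioc_lt_top ?_ C ?_
  · exact aestronglyMeasurable_of_tendsto_ae atTop
      (fun N => (integrable_upperStep φ _ _).aestronglyMeasurable.restrict)
      (hφ.ae_tendsto_upperStep (isSubdivision_uniformSubdivision hab)
        (meshTendstoZero_uniformSubdivision a b))
  · filter_upwards [ae_restrict_mem measurableSet_Ioc] with s hs
    exact hC s (Ioc_subset_Icc_self hs)

theorem integral_le_upperDarboux (hφ : RiemannIntegrable φ a b) (hq : IsSubdivision a b n q) :
    ∫ s in Ioc a b, φ s ≤ upperDarboux φ n q := by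
  obtain ⟨C, hC⟩ := hφ.bounded
  rw [← setIntegral_upperStep hq φ]
  exact setIntegral_mono_on hφ.integrableOn (integrable_upperStep φ n q).integrableOn
    measurableSet_Ioc fun s hs => (upperStep_mem_Icc hq hC hs).1

theorem tendsto_upperDarboux (hφ : RiemannIntegrable φ a b) {n : ℕ → ℕ} {q : ℕ → ℕ → ℝ}
    (hq : ∀ N, IsSubdivision a b (n N) (q N)) (hmesh : MeshTendstoZero n q) :
    Tendsto (fun N => upperDarboux φ (n N) (q N)) atTop (𝓝 (∫ s in Ioc a b, φ s)) := by
  obtain ⟨C, hC⟩ := hφ.bounded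
  simp only [← setIntegral_upperStep (hq _) φ]
  refine tendsto_integral_of_dominated_convergence (fun _ => C)
    (fun N => (integrable_upperStep φ _ _).aestronglyMeasurable.restrict)
    (integrableOn_const measure_Ioc_lt_top.ne) (fun N => ?_) (hφ.ae_tendsto_upperStep hq hmesh)
  filter_upwards [ae_restrict_mem measurableSet_Ioc] with s hs
  exact abs_upperStep_le (hq N) hC hs

end RiemannIntegrable

end Darboux

namespace RiemannIntegrable

variable {φ ψ : ℝ → ℝ} {a b : ℝ}

theorem mono (hφ : RiemannIntegrable φ a b) {c d : ℝ} (hac : a ≤ c) (hdb : d ≤ b) :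
    RiemannIntegrable φ c d where
  bounded := hφ.bounded.imp fun _ hC s hs => hC s (Icc_subset_Icc hac hdb hs)
  ae_continuousAt := hφ.ae_continuousAt.mono fun _ h hs => h (Ioo_subset_Ioo hac hdb hs)

theorem neg (hφ : RiemannIntegrable φ a b) : RiemannIntegrable (-φ) a b where
  bounded := by simpa using hφ.bounded
  ae_continuousAt := hφ.ae_continuousAt.mono fun _ h hs => (h hs).neg

theorem mul (hφ : RiemannIntegrable φ a b) (hψ : RiemannIntegrable ψ a b) :
    RiemannIntegrable (fun s => φ s * ψ s) a b where
  bounded := by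
    obtain ⟨C, hC⟩ := hφ.bounded
    obtain ⟨D, hD⟩ := hψ.bounded
    refine ⟨C * D, fun s hs => ?_⟩
    rw [abs_mul]
    exact mul_le_mul (hC s hs) (hD s hs) (abs_nonneg _) ((abs_nonneg _).trans (hC s hs))
  ae_continuousAt := by
    filter_upwards [hφ.ae_continuousAt, hψ.ae_continuousAt] with s hφs hψs hs
    exact (hφs hs).mul (hψs hs)

theorem of_continuousOn (hφ : ContinuousOn φ (Icc a b)) : RiemannIntegrable φ a b where
  bounded := isCompact_Icc.exists_bound_of_continuousOn hφ
  ae_continuousAt := .of_forall fun _ hs =>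
    hφ.continuousAt (mem_of_superset (Ioo_mem_nhds hs.1 hs.2) Ioo_subset_Icc_self)

theorem comp_sub_left (hφ : RiemannIntegrable φ a b) (c : ℝ) :
    RiemannIntegrable (fun s => φ (c - s)) (c - b) (c - a) where
  bounded := hφ.bounded.imp fun _ hC s hs => hC _ (by constructor <;> linarith [hs.1, hs.2])
  ae_continuousAt := by
    filter_upwards [(Measure.measurePreserving_sub_left volume c).quasiMeasurePreserving.ae
      hφ.ae_continuousAt] with s h hs
    exact ContinuousAt.comp (h (by constructor <;> linarith [hs.1, hs.2]))
      (continuous_const.sub continuous_id).continuousAt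

end RiemannIntegrable

section Substitution

theorem lowerSum_eq_neg_upperSum_neg (F : Set ℝ) (α l : ℝ) (h : ℝ → ℝ) (n : ℕ) (p : ℕ → ℝ) :
    lowerSum F α l h n p = -upperSum F α l (-h) n p := by
  simp only [lowerSum, upperSum, ← Finset.sum_neg_distrib, ← neg_mul]
  refine Finset.sum_congr rfl fun i _ => ?_
  rw [Real.sInf_def, ← image_neg_eq_neg, image_image]
  rfl

theorem lowerIntegral_eq_neg_upperIntegral_neg (F : Set ℝ) (α l : ℝ) (h : ℝ → ℝ) (a b : ℝ) :
    lowerIntegral F α l h a b = -upperIntegral F α l (-h) a b := by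
  rw [lowerIntegral, upperIntegral, Real.sInf_def, neg_neg]
  congr 1
  ext u
  simp [lowerSum_eq_neg_upperSum_neg, neg_eq_iff_eq_neg]

variable {F : Set ℝ} {α l : ℝ} {h φ : ℝ → ℝ} {a b : ℝ}

theorem upperSum_eq_upperDarboux (hF : IsClosed F) (hS : IsStaircase F (staircase F α l))
    (hh : EqOn h (φ ∘ staircase F α l) (F ∩ Icc a b)) {n : ℕ} {p : ℕ → ℝ}
    (hp : IsSubdivision a b n p) :
    upperSum F α l h n p = upperDarboux φ n (staircase F α l ∘ p) := by
  refine Finset.sum_congr rfl fun i hi => ?_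
  have hin := Finset.mem_range.1 hi
  rcases (hS.monotone (hp.2.2 i hin)).eq_or_lt with heq | hlt
  · simp [heq]
  · rw [(hh.mono (inter_subset_inter_right F (hp.Icc_subset hin))).image_eq, image_comp,
      hS.image_inter_Icc hF hlt]
    rfl

theorem RiemannIntegrable.upperIntegral_eq (hF : IsClosed F)
    (hS : IsStaircase F (staircase F α l)) (hab : a ≤ b)
    (hh : EqOn h (φ ∘ staircase F α l) (F ∩ Icc a b))
    (hφ : RiemannIntegrable φ (staircase F α l a) (staircase F α l b)) :
    upperIntegral F α l h a b = ∫ s in staircase F α l a..staircase F α l b, φ s := by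
  rw [intervalIntegral.integral_of_le (hS.monotone hab)]
  have huniform := isSubdivision_uniformSubdivision hab
  have hlower : ∀ u ∈ {u | ∃ n p, IsSubdivision a b n p ∧ upperSum F α l h n p = u},
      ∫ s in Ioc (staircase F α l a) (staircase F α l b), φ s ≤ u := by
    rintro _ ⟨n, p, hp, rfl⟩
    rw [upperSum_eq_upperDarboux hF hS hh hp]
    exact hφ.integral_le_upperDarboux (hp.comp hS.monotone)
  refine le_antisymm (ge_of_tendsto' (hφ.tendsto_upperDarboux
    (fun N => (huniform N).comp hS.monotone)
    ((meshTendstoZero_uniformSubdivision a b).comp hS.monotone hS.continuous huniform))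
    fun N => ?_) (le_csInf ⟨_, _, _, huniform 0, rfl⟩ hlower)
  rw [← upperSum_eq_upperDarboux hF hS hh (huniform N)]
  exact csInf_le ⟨_, hlower⟩ ⟨_, _, huniform N, rfl⟩

theorem RiemannIntegrable.integrable (hF : IsClosed F) (hS : IsStaircase F (staircase F α l))
    (hab : a ≤ b) (hh : EqOn h (φ ∘ staircase F α l) (F ∩ Icc a b))
    (hφ : RiemannIntegrable φ (staircase F α l a) (staircase F α l b)) :
    Integrable F α l h a b := by
  refine ⟨hφ.bounded.imp fun C hC x hx => ?_, ?_⟩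
  · rw [hh hx]
    exact hC _ ⟨hS.monotone hx.2.1, hS.monotone hx.2.2⟩
  · have hneg : EqOn (-h) ((-φ) ∘ staircase F α l) (F ∩ Icc a b) := fun x hx =>
      congrArg Neg.neg (hh hx)
    rw [lowerIntegral_eq_neg_upperIntegral_neg, hφ.neg.upperIntegral_eq hF hS hab hneg,
      hφ.upperIntegral_eq hF hS hab hh]
    simp only [Pi.neg_apply, intervalIntegral.integral_neg, neg_neg]

theorem exists_upperDarboux_lt (hF : IsClosed F) (hS : IsStaircase F (staircase F α l))
    (hab : a ≤ b) (hh : EqOn h (φ ∘ staircase F α l) (F ∩ Icc a b)) {ε : ℝ} (hε : 0 < ε) :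
    ∃ n q, IsSubdivision (staircase F α l a) (staircase F α l b) n q ∧
      upperDarboux φ n q < upperIntegral F α l h a b + ε := by
  have hnonempty : {u | ∃ n p, IsSubdivision a b n p ∧ upperSum F α l h n p = u}.Nonempty :=
    ⟨_, _, _, isSubdivision_uniformSubdivision hab 0, rfl⟩
  obtain ⟨_, ⟨n, p, hp, rfl⟩, hlt⟩ := exists_lt_of_csInf_lt hnonempty
    (lt_add_of_pos_right (upperIntegral F α l h a b) hε)
  rw [upperSum_eq_upperDarboux hF hS hh hp] at hlt
  exact ⟨n, _, hp.comp hS.monotone, hlt⟩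

theorem exists_bound_of_eqOn_comp_staircase (hF : IsClosed F)
    (hS : IsStaircase F (staircase F α l)) (hab : a ≤ b)
    (hh : EqOn h (φ ∘ staircase F α l) (F ∩ Icc a b))
    (hbounded : ∃ C, ∀ x ∈ F ∩ Icc a b, |h x| ≤ C) :
    ∃ C, ∀ s ∈ Icc (staircase F α l a) (staircase F α l b), |φ s| ≤ C := by
  rcases (hS.monotone hab).eq_or_lt with heq | hlt
  · rw [← heq, Icc_self]
    exact ⟨|φ (staircase F α l a)|, fun s hs => (congrArg (|φ ·|) hs).le⟩
  · obtain ⟨C, hC⟩ := hbounded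
    refine ⟨C, ?_⟩
    rw [← hS.image_inter_Icc hF hlt, forall_mem_image]
    intro x hx
    exact (congrArg abs (hh hx)).symm.trans_le (hC x hx)

theorem integrable_iff_riemannIntegrable (hF : IsClosed F)
    (hS : IsStaircase F (staircase F α l)) (hab : a ≤ b)
    (hh : EqOn h (φ ∘ staircase F α l) (F ∩ Icc a b)) :
    Integrable F α l h a b ↔
      RiemannIntegrable φ (staircase F α l a) (staircase F α l b) := by
  refine ⟨fun ⟨hbounded, heq⟩ => ?_, fun hφ => hφ.integrable hF hS hab hh⟩
  obtain ⟨C, hC⟩ := exists_bound_of_eqOn_comp_staircase hF hS hab hh hbounded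
  have hneg : EqOn (-h) ((-φ) ∘ staircase F α l) (F ∩ Icc a b) := fun x hx =>
    congrArg Neg.neg (hh hx)
  refine riemannIntegrable_of_forall_exists_upperDarboux_lt hC fun ε hε => ?_
  obtain ⟨n, q, hq, hupper⟩ := exists_upperDarboux_lt hF hS hab hh (half_pos hε)
  obtain ⟨m, r, hr, hlower⟩ := exists_upperDarboux_lt hF hS hab hneg (half_pos hε)
  rw [lowerIntegral_eq_neg_upperIntegral_neg] at heq
  exact ⟨n, q, m, r, hq, hr, by linarith⟩

theorem integral_eq_intervalIntegral (hF : IsClosed F) (hS : IsStaircase F (staircase F α l))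
    (hab : a ≤ b) (hh : EqOn h (φ ∘ staircase F α l) (F ∩ Icc a b))
    (hint : Integrable F α l h a b) :
    integral F α l h a b = ∫ s in staircase F α l a..staircase F α l b, φ s :=
  ((integrable_iff_riemannIntegrable hF hS hab hh).1 hint).upperIntegral_eq hF hS hab hh

end Substitution

/-- The convolution of two functions on the half-line. -/
noncomputable def volterraConv (φ ψ : ℝ → ℝ) (x : ℝ) : ℝ := ∫ r in 0..x, φ (x - r) * ψ r

/-- The antiderivative of `φ` that vanishes at `0`. -/
noncomputable def primitive (φ : ℝ → ℝ) (x : ℝ) : ℝ := ∫ r in 0..x, φ r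

/-- The restriction of `φ` to `(0, b)`, extended by zero. It turns convolutions on `[0, b]` into
integrals over the whole line. -/
noncomputable def trunc (φ : ℝ → ℝ) (b : ℝ) : ℝ → ℝ := (Ioo 0 b).indicator φ

section Convolution

variable {φ ψ : ℝ → ℝ} {b x : ℝ}

theorem volterraConv_comm (φ ψ : ℝ → ℝ) : volterraConv φ ψ = volterraConv ψ φ := by
  funext x
  have hsub := intervalIntegral.integral_comp_sub_left (a := 0) (b := x)
    (fun r => φ (x - r) * ψ r) x
  simp only [sub_zero, sub_self, sub_sub_cancel] at hsub
  simp only [volterraConv, ← hsub, mul_comm (ψ _)]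

theorem volterraConv_one_left (φ : ℝ → ℝ) : volterraConv (fun _ => 1) φ = primitive φ := by
  funext x
  simp only [volterraConv, primitive, one_mul]

theorem trunc_of_nonpos (φ : ℝ → ℝ) (b : ℝ) (hx : x ≤ 0) : trunc φ b x = 0 :=
  indicator_of_notMem (fun h => h.1.not_ge hx) φ

theorem trunc_of_mem (φ : ℝ → ℝ) (hx : x ∈ Ioo 0 b) : trunc φ b x = φ x :=
  indicator_of_mem hx φ

theorem integrable_trunc (hφ : IntegrableOn φ (Ioc 0 b)) : MeasureTheory.Integrable (trunc φ b) :=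
  (hφ.mono_set Ioo_subset_Ioc_self).integrable_indicator measurableSet_Ioo

theorem volterraConv_eq_integral_trunc (φ ψ : ℝ → ℝ) (hx : 0 ≤ x) (hxb : x ≤ b) :
    volterraConv φ ψ x = ∫ r, trunc φ b (x - r) * trunc ψ b r := by
  rw [volterraConv, intervalIntegral.integral_of_le hx, integral_Ioc_eq_integral_Ioo,
    ← integral_indicator measurableSet_Ioo]
  congr 1 with r
  by_cases hr : r ∈ Ioo 0 x
  · rw [indicator_of_mem hr, trunc_of_mem ψ ⟨hr.1, hr.2.trans_le hxb⟩,
      trunc_of_mem φ ⟨sub_pos.2 hr.2, (sub_lt_self x hr.1).trans_le hxb⟩]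
  · rw [indicator_of_notMem hr]
    rcases le_or_gt r 0 with h | h
    · rw [trunc_of_nonpos ψ b h, mul_zero]
    · rw [trunc_of_nonpos φ b (sub_nonpos.2 (not_lt.1 fun hlt => hr ⟨h, hlt⟩)), zero_mul]

theorem RiemannIntegrable.exists_abs_trunc_le (hφ : RiemannIntegrable φ 0 b) :
    ∃ C, ∀ s, |trunc φ b s| ≤ C := by
  obtain ⟨C, hC⟩ := hφ.bounded
  refine ⟨max C 0, fun s => ?_⟩
  by_cases hs : s ∈ Ioo 0 b
  · rw [trunc_of_mem φ hs]
    exact (hC s (Ioo_subset_Icc_self hs)).trans (le_max_left _ _)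
  · rw [trunc, indicator_of_notMem hs, abs_zero]
    exact le_max_right _ _

theorem RiemannIntegrable.ae_continuousAt_trunc (hφ : RiemannIntegrable φ 0 b) :
    ∀ᵐ s, ContinuousAt (trunc φ b) s := by
  filter_upwards [hφ.ae_continuousAt, Measure.ae_ne volume 0, Measure.ae_ne volume b]
    with s hs h0 hb
  by_cases hmem : s ∈ Ioo 0 b
  · exact (hs hmem).congr
      ((eqOn_indicator (f := φ)).eventuallyEq_of_mem (isOpen_Ioo.mem_nhds hmem)).symm
  · have hs' : s ∈ (Icc 0 b)ᶜ := fun h => hmem ⟨h.1.lt_of_ne' h0, h.2.lt_of_ne hb⟩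
    refine (continuousAt_const (y := (0 : ℝ))).congr ?_
    filter_upwards [isClosed_Icc.isOpen_compl.mem_nhds hs'] with y hy
    exact (indicator_of_notMem (notMem_subset Ioo_subset_Icc_self hy) φ).symm

theorem RiemannIntegrable.continuous_integral_trunc (hφ : RiemannIntegrable φ 0 b)
    (hψ : IntegrableOn ψ (Ioc 0 b)) :
    Continuous fun x => ∫ r, trunc φ b (x - r) * trunc ψ b r := by
  obtain ⟨C, hC⟩ := hφ.exists_abs_trunc_le
  have hsub := fun x : ℝ => (Measure.measurePreserving_sub_left volume x).quasiMeasurePreserving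
  refine continuous_iff_continuousAt.2 fun x₀ => ?_
  refine continuousAt_of_dominated (bound := fun r => C * |trunc ψ b r|)
    (.of_forall fun x => ?_) (.of_forall fun x => .of_forall fun r => ?_)
    ((integrable_trunc hψ).abs.const_mul C) ?_
  · exact ((integrable_trunc hφ.integrableOn).aestronglyMeasurable.comp_quasiMeasurePreserving
      (hsub x)).mul (integrable_trunc hψ).aestronglyMeasurable
  · rw [Real.norm_eq_abs, abs_mul]
    exact mul_le_mul_of_nonneg_right (hC _) (abs_nonneg _)
  · filter_upwards [(hsub x₀).ae hφ.ae_continuousAt_trunc] with r hr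
    exact (ContinuousAt.comp (f := fun x => x - r) hr (by fun_prop)).mul continuousAt_const

theorem continuousOn_volterraConv (hφ : ∀ b, RiemannIntegrable φ 0 b)
    (hψ : ∀ b, IntegrableOn ψ (Ioc 0 b)) : ContinuousOn (volterraConv φ ψ) (Ici 0) := by
  intro x hx
  have hcont := (hφ (x + 1)).continuous_integral_trunc (hψ (x + 1))
  refine hcont.continuousWithinAt.congr_of_eventuallyEq ?_
    (volterraConv_eq_integral_trunc φ ψ hx (by linarith))
  filter_upwards [self_mem_nhdsWithin, mem_nhdsWithin_of_mem_nhds (Iio_mem_nhds (lt_add_one x))]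
    with y hy hyx
  exact volterraConv_eq_integral_trunc φ ψ hy (le_of_lt hyx)

theorem continuousOn_primitive (hφ : ∀ b, IntegrableOn φ (Ioc 0 b)) :
    ContinuousOn (primitive φ) (Ici 0) :=
  volterraConv_one_left φ ▸ continuousOn_volterraConv
    (fun _ => .of_continuousOn continuousOn_const) hφ

theorem integral_trunc_sub (φ : ℝ → ℝ) {r : ℝ} (hr : r ∈ Ioo 0 x) (hφ : IntegrableOn φ (Ioc 0 x)) :
    ∫ y in 0..x, trunc φ x (y - r) = primitive φ (x - r) := by
  have hint := integrable_trunc hφ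
  have hleft : ∫ y in (0 - r)..0, trunc φ x y = 0 := by
    refine intervalIntegral.integral_zero_ae (.of_forall fun y hy => ?_)
    rw [uIoc_of_le (by linarith [hr.1])] at hy
    exact trunc_of_nonpos φ x hy.2
  rw [intervalIntegral.integral_comp_sub_right, ← intervalIntegral.integral_add_adjacent_intervals
    (b := 0) hint.intervalIntegrable hint.intervalIntegrable, hleft, zero_add, primitive]
  refine intervalIntegral.integral_congr_Ioo_of_le (by linarith [hr.2]) fun y hy => ?_
  exact trunc_of_mem φ ⟨hy.1, hy.2.trans (sub_lt_self x hr.1)⟩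

theorem primitive_volterraConv (hx : 0 ≤ x) (hφ : IntegrableOn φ (Ioc 0 x))
    (hψ : IntegrableOn ψ (Ioc 0 x)) :
    primitive (volterraConv φ ψ) x = volterraConv (primitive φ) ψ x := by
  have hprod : MeasureTheory.Integrable
      (Function.uncurry fun y r => trunc φ x (y - r) * trunc ψ x r)
      ((volume.restrict (Ioc 0 x)).prod volume) := by
    have hconv := (integrable_trunc hψ).convolution_integrand (ContinuousLinearMap.mul ℝ ℝ)
      (integrable_trunc hφ) (μ := volume) (ν := volume)
    simp only [ContinuousLinearMap.mul_apply', mul_comm (trunc ψ x _)] at hconv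
    exact hconv.mono_measure (Measure.prod_mono Measure.restrict_le_self le_rfl)
  have hinner : ∀ r, ∫ y in Ioc 0 x, trunc φ x (y - r) * trunc ψ x r =
      (Ioo 0 x).indicator (fun r => primitive φ (x - r) * ψ r) r := by
    intro r
    rw [integral_mul_const]
    by_cases hr : r ∈ Ioo 0 x
    · rw [indicator_of_mem hr, trunc_of_mem ψ hr, ← intervalIntegral.integral_of_le hx,
        integral_trunc_sub φ hr hφ]
    · rw [indicator_of_notMem hr, trunc, trunc, indicator_of_notMem (f := ψ) hr, mul_zero]
  calc primitive (volterraConv φ ψ) x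
      = ∫ y in Ioc 0 x, ∫ r, trunc φ x (y - r) * trunc ψ x r := by
        rw [primitive, intervalIntegral.integral_of_le hx]
        exact setIntegral_congr_fun measurableSet_Ioc fun y hy =>
          volterraConv_eq_integral_trunc φ ψ hy.1.le hy.2
    _ = ∫ r, ∫ y in Ioc 0 x, trunc φ x (y - r) * trunc ψ x r := integral_integral_swap hprod
    _ = ∫ r in Ioo 0 x, primitive φ (x - r) * ψ r := by
        simp only [hinner, integral_indicator measurableSet_Ioo]
    _ = volterraConv (primitive φ) ψ x := by
        rw [← integral_Ioc_eq_integral_Ioo, ← intervalIntegral.integral_of_le hx, volterraConv]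

end Convolution

section Limits

variable {φ ψ G H : ℝ → ℝ} {A B C : ℝ}

theorem exists_bound_of_tendsto (hG : ContinuousOn G (Ici 0)) (hA : Tendsto G atTop (𝓝 A)) :
    ∃ M, ∀ y, 0 ≤ y → |G y| ≤ M := by
  obtain ⟨N, hN⟩ := eventually_atTop.1 (hA.abs.eventually (gt_mem_nhds (lt_add_one |A|)))
  obtain ⟨C, hC⟩ := (isCompact_Icc (b := N)).exists_bound_of_continuousOn
    (hG.mono Icc_subset_Ici_self)
  refine ⟨max C (|A| + 1), fun y hy => ?_⟩
  rcases le_total y N with h | h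
  · exact (hC y ⟨hy, h⟩).trans (le_max_left _ _)
  · exact (hN y h).le.trans (le_max_right _ _)

theorem inv_mul_volterraConv_eq (G H : ℝ → ℝ) {x : ℝ} (hx : 0 < x) :
    x⁻¹ * volterraConv G H x = ∫ u in Ioc (0 : ℝ) 1, G (x - x * u) * H (x * u) := by
  have hscale := intervalIntegral.smul_integral_comp_mul_left (a := 0) (b := 1)
    (fun r => G (x - r) * H r) x
  rw [mul_zero, mul_one, smul_eq_mul] at hscale
  rw [volterraConv, ← hscale, intervalIntegral.integral_of_le zero_le_one,
    inv_mul_cancel_left₀ hx.ne']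

theorem tendsto_inv_mul_volterraConv (hG : ContinuousOn G (Ici 0)) (hH : ContinuousOn H (Ici 0))
    (hA : Tendsto G atTop (𝓝 A)) (hB : Tendsto H atTop (𝓝 B)) :
    Tendsto (fun x => x⁻¹ * volterraConv G H x) atTop (𝓝 (A * B)) := by
  obtain ⟨M, hM⟩ := exists_bound_of_tendsto hG hA
  obtain ⟨M', hM'⟩ := exists_bound_of_tendsto hH hB
  have hnonneg : ∀ {x u : ℝ}, 0 < x → u ∈ Ioc (0 : ℝ) 1 → 0 ≤ x - x * u ∧ 0 ≤ x * u :=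
    fun hx hu => ⟨by nlinarith [hu.2], mul_nonneg hx.le hu.1.le⟩
  have hconst : A * B = ∫ _ in Ioc (0 : ℝ) 1, A * B := by simp
  rw [hconst]
  refine Tendsto.congr' ((eventually_gt_atTop 0).mono fun x hx =>
    (inv_mul_volterraConv_eq G H hx).symm) ?_
  refine tendsto_integral_filter_of_dominated_convergence (fun _ => M * M') ?_ ?_
    (integrable_const _) ?_
  · filter_upwards [eventually_gt_atTop 0] with x hx
    exact ((hG.comp (by fun_prop) fun u hu => (hnonneg hx hu).1).mul
      (hH.comp (by fun_prop) fun u hu => (hnonneg hx hu).2)).aestronglyMeasurable measurableSet_Ioc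
  · filter_upwards [eventually_gt_atTop 0] with x hx
    filter_upwards [ae_restrict_mem measurableSet_Ioc] with u hu
    obtain ⟨hsub, hmul⟩ := hnonneg hx hu
    rw [Real.norm_eq_abs, abs_mul]
    exact mul_le_mul (hM _ hsub) (hM' _ hmul) (abs_nonneg _) ((abs_nonneg _).trans (hM _ hsub))
  · rw [← restrict_Ioo_eq_restrict_Ioc]
    filter_upwards [ae_restrict_mem measurableSet_Ioo] with u hu
    have hsub : Tendsto (fun x : ℝ => x - x * u) atTop atTop := by
      simpa only [mul_sub, mul_one, id] using tendsto_id.atTop_mul_const (sub_pos.2 hu.2)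
    exact (hA.comp hsub).mul (hB.comp (tendsto_id.atTop_mul_const hu.1))

theorem eq_mul_of_tendsto_primitive_volterraConv (hφ : ∀ b, IntegrableOn φ (Ioc 0 b))
    (hψ : ∀ b, IntegrableOn ψ (Ioc 0 b)) (hA : Tendsto (primitive φ) atTop (𝓝 A))
    (hB : Tendsto (primitive ψ) atTop (𝓝 B))
    (hC : Tendsto (primitive (volterraConv φ ψ)) atTop (𝓝 C)) : C = A * B := by
  have hcont := continuousOn_primitive hφ
  have hRI : ∀ b, RiemannIntegrable (primitive φ) 0 b := fun b =>
    .of_continuousOn (hcont.mono Icc_subset_Ici_self)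
  have hconv : EqOn (primitive (volterraConv φ ψ)) (volterraConv (primitive φ) ψ) (Ici 0) :=
    fun x hx => primitive_volterraConv hx (hφ x) (hψ x)
  have hmeanC := tendsto_inv_mul_volterraConv (continuousOn_const (c := (1 : ℝ)))
    ((continuousOn_volterraConv hRI hψ).congr hconv) tendsto_const_nhds hC
  have hmeanAB := tendsto_inv_mul_volterraConv hcont (continuousOn_primitive hψ) hA hB
  rw [one_mul] at hmeanC
  refine tendsto_nhds_unique hmeanC (hmeanAB.congr' ?_)
  filter_upwards [eventually_ge_atTop 0] with x hx
  congr 1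
  calc volterraConv (primitive φ) (primitive ψ) x
      = primitive (volterraConv (primitive φ) ψ) x := by
        rw [volterraConv_comm, ← primitive_volterraConv hx (hψ x) (hRI x).integrableOn,
          volterraConv_comm]
    _ = primitive (primitive (volterraConv φ ψ)) x :=
        intervalIntegral.integral_congr_Ioo_of_le hx fun y hy => (hconv hy.1.le).symm
    _ = volterraConv (fun _ => 1) (primitive (volterraConv φ ψ)) x := by
        rw [volterraConv_one_left]

theorem integrableOn_Ioi_of_tendsto_primitive_abs (hφ : ∀ b, IntegrableOn φ (Ioc 0 b))
    (hA : Tendsto (primitive fun s => |φ s|) atTop (𝓝 A)) : IntegrableOn φ (Ioi 0) :=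
  integrableOn_Ioi_of_intervalIntegral_norm_tendsto A 0 hφ tendsto_id hA

theorem tendsto_primitive_volterraConv (hφ : IntegrableOn φ (Ioi 0))
    (hψ : ∀ b, IntegrableOn ψ (Ioc 0 b)) (hB : Tendsto (primitive ψ) atTop (𝓝 B)) :
    Tendsto (primitive (volterraConv φ ψ)) atTop (𝓝 ((∫ r in Ioi 0, φ r) * B)) := by
  have hcont := continuousOn_primitive hψ
  obtain ⟨M, hM⟩ := exists_bound_of_tendsto hcont hB
  have hrw : ∀ᶠ x : ℝ in atTop, ∫ r in Ioi 0, (Ioc 0 x).indicator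
      (fun r => primitive ψ (x - r) * φ r) r = primitive (volterraConv φ ψ) x := by
    filter_upwards [eventually_ge_atTop 0] with x hx
    rw [volterraConv_comm, primitive_volterraConv hx (hψ x) (hφ.mono_set Ioc_subset_Ioi_self),
      volterraConv, intervalIntegral.integral_of_le hx, setIntegral_indicator measurableSet_Ioc,
      inter_eq_right.2 Ioc_subset_Ioi_self]
  rw [mul_comm, ← integral_const_mul]
  refine Tendsto.congr' hrw (tendsto_integral_filter_of_dominated_convergence
    (fun r => M * |φ r|) (.of_forall fun x => ?_) (.of_forall fun x => .of_forall fun r => ?_)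
    (hφ.abs.const_mul M) ?_)
  · have hsub : ContinuousOn (fun r => primitive ψ (x - r)) (Ioc 0 x) :=
      hcont.comp (by fun_prop) fun r hr => sub_nonneg.2 hr.2
    exact ((aestronglyMeasurable_indicator_iff measurableSet_Ioc).2
      ((hsub.aestronglyMeasurable measurableSet_Ioc).mul
        (hφ.mono_set Ioc_subset_Ioi_self).aestronglyMeasurable)).restrict
  · by_cases hr : r ∈ Ioc 0 x
    · rw [indicator_of_mem hr, Real.norm_eq_abs, abs_mul]
      exact mul_le_mul_of_nonneg_right (hM _ (sub_nonneg.2 hr.2)) (abs_nonneg _)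
    · rw [indicator_of_notMem hr, norm_zero]
      exact mul_nonneg ((abs_nonneg _).trans (hM 0 le_rfl)) (abs_nonneg _)
  · filter_upwards [ae_restrict_mem measurableSet_Ioi] with r hr
    refine ((hB.comp (tendsto_atTop_add_const_right _ (-r) tendsto_id)).mul_const (φ r)).congr' ?_
    filter_upwards [eventually_ge_atTop r] with x hx
    exact (indicator_of_mem (show r ∈ Ioc 0 x from ⟨hr, hx⟩)
      (fun r => primitive ψ (x - r) * φ r)).symm

end Limits

/-- The improper Riemann integral of `φ` over `[0, ∞)` exists and is equal to `I`. -/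
structure HasImproperIntegral (φ : ℝ → ℝ) (I : ℝ) : Prop where
  riemannIntegrable : ∀ b, RiemannIntegrable φ 0 b
  tendsto : Tendsto (primitive φ) atTop (𝓝 I)

namespace HasImproperIntegral

variable {φ ψ : ℝ → ℝ} {A B C : ℝ}

theorem integrableOn (hφ : HasImproperIntegral φ A) (b : ℝ) : IntegrableOn φ (Ioc 0 b) :=
  (hφ.riemannIntegrable b).integrableOn

theorem eq_mul_of_volterraConv (hφ : HasImproperIntegral φ A) (hψ : HasImproperIntegral ψ B)
    (hconv : HasImproperIntegral (volterraConv φ ψ) C) : C = A * B :=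
  eq_mul_of_tendsto_primitive_volterraConv hφ.integrableOn hψ.integrableOn hφ.tendsto hψ.tendsto
    hconv.tendsto

theorem exists_volterraConv (hφ : HasImproperIntegral φ A) (hψ : HasImproperIntegral ψ B)
    (habs : HasImproperIntegral (fun s => |φ s|) C) :
    ∃ I, HasImproperIntegral (volterraConv φ ψ) I := by
  have hcont := continuousOn_volterraConv hφ.riemannIntegrable hψ.integrableOn
  have hint := integrableOn_Ioi_of_tendsto_primitive_abs hφ.integrableOn habs.tendsto
  exact ⟨_, fun _ => .of_continuousOn (hcont.mono Icc_subset_Ici_self),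
    tendsto_primitive_volterraConv hint hψ.integrableOn hψ.tendsto⟩

end HasImproperIntegral

/-- The function `s ↦ e^{-p s} φ(s)`, whose integral is the Laplace transform of `φ` at `p`. -/
noncomputable def expMul (p : ℝ) (φ : ℝ → ℝ) (s : ℝ) : ℝ := Real.exp (-(p * s)) * φ s

/-- The integrand `e^{-p S(t)} h(t)` common to the Laplace transform, with `p = S(v)`, and the
Sumudu transform, with `p = 1 / S(v)`. -/
noncomputable def expIntegrand (F : Set ℝ) (α l p : ℝ) (h : ℝ → ℝ) (t : ℝ) : ℝ :=
  Real.exp (-(p * staircase F α l t)) * h t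

theorem sumuduIntegrand_eq_expIntegrand (F : Set ℝ) (α l : ℝ) (h : ℝ → ℝ) (v : ℝ) :
    sumuduIntegrand F α l h v = expIntegrand F α l (staircase F α l v)⁻¹ h := by
  funext t
  rw [sumuduIntegrand, expIntegrand, div_eq_inv_mul]

theorem expIntegrand_onFractal (F : Set ℝ) (α l p : ℝ) (f : ℝ → ℝ) :
    expIntegrand F α l p (onFractal F α l f) = expMul p f ∘ staircase F α l :=
  rfl

theorem expMul_volterraConv (p : ℝ) (φ ψ : ℝ → ℝ) :
    expMul p (volterraConv φ ψ) = volterraConv (expMul p φ) (expMul p ψ) := by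
  funext x
  rw [expMul, volterraConv, volterraConv, ← intervalIntegral.integral_const_mul]
  congr 1 with r
  have hexp : Real.exp (-(p * x)) = Real.exp (-(p * (x - r))) * Real.exp (-(p * r)) := by
    rw [← Real.exp_add]
    ring_nf
  rw [hexp, expMul, expMul]
  ring

theorem expMul_neg_expMul (p : ℝ) (φ : ℝ → ℝ) : expMul (-p) (expMul p φ) = φ := by
  funext s
  rw [expMul, expMul, ← mul_assoc, ← Real.exp_add, neg_mul, neg_neg, add_neg_cancel, Real.exp_zero,
    one_mul]

theorem RiemannIntegrable.of_expMul {φ : ℝ → ℝ} {a b p : ℝ}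
    (hφ : RiemannIntegrable (expMul p φ) a b) : RiemannIntegrable φ a b :=
  expMul_neg_expMul p φ ▸ RiemannIntegrable.mul (.of_continuousOn (by fun_prop)) hφ

theorem map_atTop_of_continuous {S : ℝ → ℝ} (hcont : Continuous S)
    (htop : Tendsto S atTop atTop) : map S atTop = atTop := by
  refine le_antisymm htop fun s hs => ?_
  obtain ⟨a, ha⟩ := mem_atTop_sets.1 hs
  refine mem_atTop_sets.2 ⟨S a, fun y hy => ?_⟩
  obtain ⟨b, hb, hab⟩ := ((htop.eventually_ge_atTop y).and (eventually_ge_atTop a)).exists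
  obtain ⟨t, ht, rfl⟩ := intermediate_value_Icc hab hcont.continuousOn ⟨hy, hb⟩
  exact ha t ht.1

section HalfLine

variable {F : Set ℝ} {α l : ℝ} {h φ : ℝ → ℝ} {I : ℝ}
  (hF : IsClosed F) (hS : IsStaircase F (staircase F α l)) (hzero : staircase F α l 0 = 0)
  (htop : Tendsto (staircase F α l) atTop atTop)

include hF hS hzero htop

theorem forall_integrable_iff_riemannIntegrable
    (hh : EqOn h (φ ∘ staircase F α l) (F ∩ Ici 0)) :
    (∀ b, 0 ≤ b → Integrable F α l h 0 b) ↔ ∀ b, RiemannIntegrable φ 0 b := by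
  have hiff : ∀ b, 0 ≤ b →
      (Integrable F α l h 0 b ↔ RiemannIntegrable φ 0 (staircase F α l b)) := by
    intro b hb
    rw [integrable_iff_riemannIntegrable hF hS hb
      (hh.mono (inter_subset_inter_right F Icc_subset_Ici_self)), hzero]
  refine ⟨fun hint s => ?_, fun hφ b hb => (hiff b hb).2 (hφ _)⟩
  obtain ⟨b, hsb, hb⟩ := ((htop.eventually_ge_atTop s).and (eventually_ge_atTop 0)).exists
  exact ((hiff b hb).1 (hint b hb)).mono le_rfl hsb

theorem tendsto_integral_iff (hh : EqOn h (φ ∘ staircase F α l) (F ∩ Ici 0))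
    (hint : ∀ b, 0 ≤ b → Integrable F α l h 0 b) :
    Tendsto (fun b => integral F α l h 0 b) atTop (𝓝 I) ↔ Tendsto (primitive φ) atTop (𝓝 I) := by
  conv_rhs => rw [← map_atTop_of_continuous hS.continuous htop, tendsto_map'_iff]
  refine tendsto_congr' ?_
  filter_upwards [eventually_ge_atTop 0] with b hb
  rw [integral_eq_intervalIntegral hF hS hb
    (hh.mono (inter_subset_inter_right F Icc_subset_Ici_self)) (hint b hb), hzero]
  rfl

theorem improperIntegrable_iff (hh : EqOn h (φ ∘ staircase F α l) (F ∩ Ici 0)) :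
    ImproperIntegrable F α l h ↔ ∃ I, HasImproperIntegral φ I := by
  have hiff := forall_integrable_iff_riemannIntegrable hF hS hzero htop hh
  constructor
  · rintro ⟨hint, I, hI⟩
    exact ⟨I, hiff.1 hint, (tendsto_integral_iff hF hS hzero htop hh hint).1 hI⟩
  · rintro ⟨I, hφ, hI⟩
    exact ⟨hiff.2 hφ, I, (tendsto_integral_iff hF hS hzero htop hh (hiff.2 hφ)).2 hI⟩

theorem improperIntegral_eq (hh : EqOn h (φ ∘ staircase F α l) (F ∩ Ici 0))
    (hI : HasImproperIntegral φ I) : improperIntegral F α l h = I := by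
  have hint := (forall_integrable_iff_riemannIntegrable hF hS hzero htop hh).2 hI.riemannIntegrable
  exact ((tendsto_integral_iff hF hS hzero htop hh hint).2 hI.tendsto).limUnder_eq

end HalfLine

section Convolution

variable {F : Set ℝ} {α l : ℝ} {f g : ℝ → ℝ}
  (hF : IsClosed F) (hS : IsStaircase F (staircase F α l)) (hzero : staircase F α l 0 = 0)

include hF hS hzero

theorem integrable_convIntegrand (hf : ∀ b, RiemannIntegrable f 0 b)
    (hg : ∀ b, RiemannIntegrable g 0 b) {t : ℝ} (ht : 0 ≤ t) :
    Integrable F α l (convIntegrand F α l f g t) 0 t := by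
  refine (integrable_iff_riemannIntegrable hF hS ht
    (φ := fun r => f (staircase F α l t - r) * g r) fun _ _ => rfl).2 ?_
  have hfsub := (hf (staircase F α l t)).comp_sub_left (staircase F α l t)
  rw [sub_self, sub_zero] at hfsub
  rw [hzero]
  exact hfsub.mul (hg _)

theorem eqOn_conv (hf : ∀ b, RiemannIntegrable f 0 b) (hg : ∀ b, RiemannIntegrable g 0 b) :
    EqOn (conv F α l f g) (volterraConv f g ∘ staircase F α l) (Ici 0) := by
  intro t ht
  have hsubst := integral_eq_intervalIntegral hF hS ht
    (φ := fun r => f (staircase F α l t - r) * g r) (fun _ _ => rfl)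
    (integrable_convIntegrand hF hS hzero hf hg ht)
  rwa [hzero] at hsubst

theorem eqOn_expIntegrand_conv (p : ℝ) (hf : ∀ b, RiemannIntegrable f 0 b)
    (hg : ∀ b, RiemannIntegrable g 0 b) :
    EqOn (expIntegrand F α l p (conv F α l f g))
      (volterraConv (expMul p f) (expMul p g) ∘ staircase F α l) (F ∩ Ici 0) := by
  intro t ht
  rw [← expMul_volterraConv, expIntegrand, eqOn_conv hF hS hzero hf hg ht.2]
  rfl

end Convolution

section Transform

variable {F : Set ℝ} {α l p : ℝ} {f g : ℝ → ℝ}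
  (hF : IsClosed F) (hS : IsStaircase F (staircase F α l)) (hzero : staircase F α l 0 = 0)
  (htop : Tendsto (staircase F α l) atTop atTop)

include hF hS hzero htop

theorem exists_hasImproperIntegral_expMul
    (hf : ImproperIntegrable F α l (expIntegrand F α l p (onFractal F α l f))) :
    ∃ A, HasImproperIntegral (expMul p f) A :=
  (improperIntegrable_iff hF hS hzero htop (eqOn_refl _ _)).1 (expIntegrand_onFractal .. ▸ hf)

theorem riemannIntegrable_of_improperIntegrable_expIntegrand
    (hf : ImproperIntegrable F α l (expIntegrand F α l p (onFractal F α l f))) (b : ℝ) :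
    RiemannIntegrable f 0 b := by
  obtain ⟨A, hA⟩ := exists_hasImproperIntegral_expMul hF hS hzero htop hf
  exact (hA.riemannIntegrable b).of_expMul

variable (hf : ImproperIntegrable F α l (expIntegrand F α l p (onFractal F α l f)))
  (hg : ImproperIntegrable F α l (expIntegrand F α l p (onFractal F α l g)))

include hf hg

theorem integrable_convIntegrand_of_improperIntegrable {t : ℝ} (ht : 0 ≤ t) :
    Integrable F α l (convIntegrand F α l f g t) 0 t :=
  integrable_convIntegrand hF hS hzero
    (riemannIntegrable_of_improperIntegrable_expIntegrand hF hS hzero htop hf)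
    (riemannIntegrable_of_improperIntegrable_expIntegrand hF hS hzero htop hg) ht

theorem improperIntegrable_expIntegrand_conv_iff :
    ImproperIntegrable F α l (expIntegrand F α l p (conv F α l f g)) ↔
      ∃ I, HasImproperIntegral (volterraConv (expMul p f) (expMul p g)) I :=
  improperIntegrable_iff hF hS hzero htop (eqOn_expIntegrand_conv hF hS hzero p
    (riemannIntegrable_of_improperIntegrable_expIntegrand hF hS hzero htop hf)
    (riemannIntegrable_of_improperIntegrable_expIntegrand hF hS hzero htop hg))

theorem improperIntegrable_expIntegrand_conv
    (habs : ImproperIntegrable F α l (fun t => |expIntegrand F α l p (onFractal F α l f) t|) ∨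
      ImproperIntegrable F α l (fun t => |expIntegrand F α l p (onFractal F α l g) t|)) :
    ImproperIntegrable F α l (expIntegrand F α l p (conv F α l f g)) := by
  obtain ⟨A, hA⟩ := exists_hasImproperIntegral_expMul hF hS hzero htop hf
  obtain ⟨B, hB⟩ := exists_hasImproperIntegral_expMul hF hS hzero htop hg
  refine (improperIntegrable_expIntegrand_conv_iff hF hS hzero htop hf hg).2 ?_
  rcases habs with habs | habs
  · obtain ⟨C, hC⟩ := (improperIntegrable_iff hF hS hzero htop
      (φ := fun s => |expMul p f s|) fun _ _ => rfl).1 habs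
    exact hA.exists_volterraConv hB hC
  · obtain ⟨C, hC⟩ := (improperIntegrable_iff hF hS hzero htop
      (φ := fun s => |expMul p g s|) fun _ _ => rfl).1 habs
    exact volterraConv_comm _ _ ▸ hB.exists_volterraConv hA hC

theorem improperIntegral_expIntegrand_conv
    (hconv : ImproperIntegrable F α l (expIntegrand F α l p (conv F α l f g))) :
    improperIntegral F α l (expIntegrand F α l p (conv F α l f g)) =
      improperIntegral F α l (expIntegrand F α l p (onFractal F α l f)) *
        improperIntegral F α l (expIntegrand F α l p (onFractal F α l g)) := by
  obtain ⟨A, hA⟩ := exists_hasImproperIntegral_expMul hF hS hzero htop hf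
  obtain ⟨B, hB⟩ := exists_hasImproperIntegral_expMul hF hS hzero htop hg
  obtain ⟨C, hC⟩ := (improperIntegrable_expIntegrand_conv_iff hF hS hzero htop hf hg).1 hconv
  have heq := eqOn_expIntegrand_conv hF hS hzero p
    (fun b => (hA.riemannIntegrable b).of_expMul) fun b => (hB.riemannIntegrable b).of_expMul
  rw [improperIntegral_eq hF hS hzero htop heq hC, expIntegrand_onFractal, expIntegrand_onFractal,
    improperIntegral_eq hF hS hzero htop (eqOn_refl _ _) hA,
    improperIntegral_eq hF hS hzero htop (eqOn_refl _ _) hB]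
  exact hA.eq_mul_of_volterraConv hB hC

end Transform

end FractalCalculus

theorem proposition2p23 (F : Set ℝ) (hF : IsClosed F) (α : ℝ) (hα₀ : 0 < α) (hα₁ : α ≤ 1) (l : ℝ)
    (hfin : ∀ x y : ℝ, x ≤ y → FractalCalculus.mass F α x y ≠ ⊤)
    (hzero : FractalCalculus.staircase F α l 0 = 0)
    (htop : Filter.Tendsto (FractalCalculus.staircase F α l) Filter.atTop Filter.atTop)
    (f g : ℝ → ℝ) (v : ℝ) :
    -- the Laplace transform of the convolution
    (FractalCalculus.LaplaceExists F α l (FractalCalculus.onFractal F α l f) v →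
      FractalCalculus.LaplaceExists F α l (FractalCalculus.onFractal F α l g) v →
      (∀ t, 0 ≤ t →
        FractalCalculus.Integrable F α l (FractalCalculus.convIntegrand F α l f g t) 0 t) ∧
      (FractalCalculus.LaplaceExistsAbs F α l (FractalCalculus.onFractal F α l f) v ∨
          FractalCalculus.LaplaceExistsAbs F α l (FractalCalculus.onFractal F α l g) v →
        FractalCalculus.LaplaceExists F α l (FractalCalculus.conv F α l f g) v) ∧
      (FractalCalculus.LaplaceExists F α l (FractalCalculus.conv F α l f g) v →
        FractalCalculus.laplace F α l (FractalCalculus.conv F α l f g) v =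
          FractalCalculus.laplace F α l (FractalCalculus.onFractal F α l f) v *
            FractalCalculus.laplace F α l (FractalCalculus.onFractal F α l g) v)) ∧
    -- the Sumudu transform of the convolution
    (FractalCalculus.staircase F α l v ≠ 0 →
      FractalCalculus.SumuduExists F α l (FractalCalculus.onFractal F α l f) v →
      FractalCalculus.SumuduExists F α l (FractalCalculus.onFractal F α l g) v →
      (∀ t, 0 ≤ t →
        FractalCalculus.Integrable F α l (FractalCalculus.convIntegrand F α l f g t) 0 t) ∧
      (FractalCalculus.SumuduExistsAbs F α l (FractalCalculus.onFractal F α l f) v ∨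
          FractalCalculus.SumuduExistsAbs F α l (FractalCalculus.onFractal F α l g) v →
        FractalCalculus.SumuduExists F α l (FractalCalculus.conv F α l f g) v) ∧
      (FractalCalculus.SumuduExists F α l (FractalCalculus.conv F α l f g) v →
        FractalCalculus.sumudu F α l (FractalCalculus.conv F α l f g) v =
          FractalCalculus.staircase F α l v *
            FractalCalculus.sumudu F α l (FractalCalculus.onFractal F α l f) v *
            FractalCalculus.sumudu F α l (FractalCalculus.onFractal F α l g) v)) := by
  have hS := FractalCalculus.isStaircase_staircase hα₀ l hfin
  refine ⟨fun hf hg => ⟨fun t ht => ?_, fun habs => ?_, fun hconv => ?_⟩,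
    fun hv hf hg => ?_⟩
  · exact FractalCalculus.integrable_convIntegrand_of_improperIntegrable hF hS hzero htop hf hg ht
  · exact FractalCalculus.improperIntegrable_expIntegrand_conv hF hS hzero htop hf hg
      (habs.imp And.right And.right)
  · exact FractalCalculus.improperIntegral_expIntegrand_conv hF hS hzero htop hf hg hconv
  · simp only [FractalCalculus.SumuduExists, FractalCalculus.SumuduExistsAbs,
      FractalCalculus.sumudu, FractalCalculus.sumuduIntegrand_eq_expIntegrand] at hf hg ⊢
    refine ⟨fun t ht => ?_, fun habs => ?_, fun hconv => ?_⟩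
    · exact FractalCalculus.integrable_convIntegrand_of_improperIntegrable hF hS hzero htop hf hg ht
    · exact FractalCalculus.improperIntegrable_expIntegrand_conv hF hS hzero htop hf hg
        (habs.imp And.right And.right)
    · rw [FractalCalculus.improperIntegral_expIntegrand_conv hF hS hzero htop hf hg hconv]
      field_simp
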